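/- **Setting.** Consider the plant $$\dot x=Ax+B_1w+B_2u,\qquad z=C_1(C_2x-r)+D_{12}u,\qquad y=C_2x+D_{21}w,$$ with real matrices, $x\in\mathbb R^n$, disturbance $w$, control $u$, measurement $y$, reference $r$ and performance output $z$. Let $\mathbf C=(A_c,B_c,C_c,D_c)$ and $\mathbf K=(A_k,B_k,C_k,D_k)$ be any two controllers that stabilize the plant, i.e. the matrices $$\begin{bmatrix}A+B_2D_cC_2&B_2C_c\\B_cC_2&A_c\end{bmatrix},\qquad \begin{bmatrix}A+B_2D_kC_2&B_2C_k\\B_kC_2&A_k\end{bmatrix}$$ are stable (all eigenvalues have negative real part), and let $L,L_c$ be any matrices with $A+LC_2$ and $A_c+L_cC_c$ stable. The composite tracking controller $\mathbf K_{CQ}^T$ is $$\dot x_c=(A_c+L_cC_c)x_c-L_cu+(B_c+L_cD_c)(y-r),\quad u_c=C_cx_c+D_c(y-r),$$ $$\dot{\hat x}=A\hat x+B_2u+Lf,\quad f=C_2\hat x-y,\qquad \dot x_q=A_qx_q+B_qf,\quad u_q=C_qx_q+D_qf,\qquad u=u_c+u_q,$$ where $D_q=D_c-D_k$, $C_q=\begin{bmatrix}-C_c&-D_qC_2&C_k\end{bmatrix}$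 and $$A_q=\begin{bmatrix}A_c+L_cC_c&(B_c+L_cD_q)C_2&-L_cC_k\\0&A+B_2D_kC_2&B_2C_k\\0&B_kC_2&A_k\end{bmatrix},\qquad B_q=\begin{bmatrix}-B_c-L_cD_q\\L-B_2D_k\\-B_k\end{bmatrix}.$$ **Signals.** For real vector signals $u,v$ vanishing for $t<0$ put $R_{uv}(\tau)=\lim_{T\to\infty}\frac1T\int_0^Tu(t+\tau)v(t)'\,dt$. The spectral density $S_{uv}$ is the Fourier transform of $R_{uv}$, impulses being allowed: that is, $R_{uv}(\tau)=\frac1{2\pi}\int_{-\infty}^\infty e^{j\omega\tau}S_{uv}(j\omega)\,d\omega$ for all $\tau\in\mathbb R$, where $S_{uv}(j\omega)\,d\omega$ is a finite complex matrix-valued measure. A signal $u$ has bounded power, $u\in\mathcal P$, if it is bounded, $R_{uu}(\tau)$ exists for all $\tau$, $S_{uu}$ exists, and $\|u\|_{\mathcal P}^2:=\lim_{T\to\infty}\frac1T\int_0^T\|u(t)\|^2dt$ exists and is finite. **Theorem.** Let $w,r\in\mathcal P$ be orthogonal, i.e. $R_{wr}(\tau)$ exists for all $\tau$ and $S_{wr}=0$.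 Let $z$ be the output of the plant controlled by $\mathbf K_{CQ}^T$; let $z_1$ be the output of the plant with $r=0$ controlled by $\mathbf K$ driven by $y$; and let $z_2$ be the output of the plant with $w=0$ controlled by $\mathbf C$ driven by $y-r$ (all with arbitrary initial states). Then $z,z_1,z_2\in\mathcal P$ and $$\|z\|_{\mathcal P}^2=\|z_1\|_{\mathcal P}^2+\|z_2\|_{\mathcal P}^2,$$ $$\|z_1\|_{\mathcal P}^2=\frac1{2\pi}\int_{-\infty}^{\infty}\operatorname{Trace}\big[T_{z_1w}(j\omega)S_{ww}(j\omega)T_{z_1w}^*(j\omega)\big]d\omega,\qquad \|z_2\|_{\mathcal P}^2=\frac1{2\pi}\int_{-\infty}^{\infty}\operatorname{Trace}\big[T_{z_2r}(j\omega)S_{rr}(j\omega)T_{z_2r}^*(j\omega)\big]d\omega,$$ where $$T_{z_1w}(s)=\left[\begin{array}{cc|c}A+B_2D_kC_2&B_2C_k&B_1+B_2D_kD_{21}\\B_kC_2&A_k&B_kD_{21}\\\hline(C_1+D_{12}D_k)C_2&D_{12}C_k&D_{12}D_kD_{21}\end{array}\right],$$ $$T_{z_2r}(s)=\left[\begin{array}{cc|c}A+B_2D_cC_2&B_2C_c&-B_2D_c\\B_cC_2&A_c&-B_c\\\hline(C_1+D_{12}D_c)C_2&D_{12}C_c&-(C_1+D_{12}D_c)\end{array}\right],$$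 and $\left[\begin{array}{c|c}\mathsf A&\mathsf B\\\hline\mathsf C&\mathsf D\end{array}\right]$ denotes $\mathsf C(sI-\mathsf A)^{-1}\mathsf B+\mathsf D$. Thus, the plant being fixed, $T_{z_1w}$ depends only on $\mathbf K$ and $T_{z_2r}$ only on $\mathbf C$, and neither depends on $L$ or $L_c$. -/

import Mathlib

open MeasureTheory Filter Topology

noncomputable section

namespace MOCC

/-! ### State-space systems -/

/-- A finite-dimensional linear time-invariant state-space realization
`x' = A x + B u`, `y = C x + D u`, with real matrices. -/
structure LTI (σ ι ο : Type*) where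
  A : Matrix σ σ ℝ
  B : Matrix σ ι ℝ
  C : Matrix ο σ ℝ
  D : Matrix ο ι ℝ

/-- The transfer matrix `C (s I - A)⁻¹ B + D` at a complex frequency `s`. -/
def LTI.transfer {σ ι ο : Type*} [Fintype σ] [DecidableEq σ] (G : LTI σ ι ο) (s : ℂ) :
    Matrix ο ι ℂ :=
  G.C.map Complex.ofReal * (Matrix.scalar σ s - G.A.map Complex.ofReal)⁻¹
      * G.B.map Complex.ofReal
    + G.D.map Complex.ofReal

/-- A stable (Hurwitz) real matrix: every complex eigenvalue has negative real part. -/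
def IsHurwitz {σ : Type*} [Fintype σ] [DecidableEq σ] (M : Matrix σ σ ℝ) : Prop :=
  ∀ s ∈ spectrum ℂ (M.map Complex.ofReal), s.re < 0

/-- The data of the perturbed plant
`x' = A x + B₁ w + B₂ u`, `z = C₁ (C₂ x - r) + D₁₂ u`, `y = C₂ x + D₂₁ w`. -/
structure Plant (n m₁ m₂ p₁ p₂ : Type*) where
  A : Matrix n n ℝ
  B₁ : Matrix n m₁ ℝ
  B₂ : Matrix n m₂ ℝ
  C₁ : Matrix p₁ p₂ ℝ
  C₂ : Matrix p₂ n ℝ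
  D₁₂ : Matrix p₁ m₂ ℝ
  D₂₁ : Matrix p₂ m₁ ℝ

section Systems

variable {n m₁ m₂ p₁ p₂ nc nk : Type*}
  [Fintype n] [Fintype m₁] [Fintype m₂] [Fintype p₁] [Fintype p₂] [Fintype nc] [Fintype nk]
  [DecidableEq n] [DecidableEq nc] [DecidableEq nk]

/-- The state matrix of the feedback loop formed by `x' = A x + B₂ u`, `y = C₂ x` and the
controller `H` from `y` to `u`. -/
def Plant.loopMatrix (P : Plant n m₁ m₂ p₁ p₂) (H : LTI nc p₂ m₂) :
    Matrix (n ⊕ nc) (n ⊕ nc) ℝ :=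
  Matrix.fromBlocks (P.A + P.B₂ * H.D * P.C₂) (P.B₂ * H.C) (H.B * P.C₂) H.A

/-- The dynamic output-feedback controller `H` is (internally) stabilizing for the plant. -/
def Plant.Stabilizes (P : Plant n m₁ m₂ p₁ p₂) (H : LTI nc p₂ m₂) : Prop :=
  IsHurwitz (P.loopMatrix H)

/-- The realization of `Q` built from `C`, `K` and the gains `L`, `Lc`;
its state is `(x_{q,1}, x_{q,2}, x_{q,3})`. -/
def Plant.Q (P : Plant n m₁ m₂ p₁ p₂) (C : LTI nc p₂ m₂) (K : LTI nk p₂ m₂)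
    (L : Matrix n p₂ ℝ) (Lc : Matrix nc m₂ ℝ) : LTI (nc ⊕ (n ⊕ nk)) p₂ m₂ where
  A := Matrix.fromBlocks
    (C.A + Lc * C.C)
    (Matrix.fromCols ((C.B + Lc * (C.D - K.D)) * P.C₂) (-(Lc * K.C)))
    0
    (Matrix.fromBlocks (P.A + P.B₂ * K.D * P.C₂) (P.B₂ * K.C) (K.B * P.C₂) K.A)
  B := Matrix.fromRows (-C.B - Lc * (C.D - K.D)) (Matrix.fromRows (L - P.B₂ * K.D) (-K.B))
  C := Matrix.fromCols (-C.C) (Matrix.fromCols (-((C.D - K.D) * P.C₂)) K.C)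
  D := C.D - K.D

/-- The closed loop from `w` to `z₁` (controller `K`, no reference), which depends on `K` only. -/
def Plant.Tz₁w (P : Plant n m₁ m₂ p₁ p₂) (K : LTI nk p₂ m₂) : LTI (n ⊕ nk) m₁ p₁ where
  A := P.loopMatrix K
  B := Matrix.fromRows (P.B₁ + P.B₂ * K.D * P.D₂₁) (K.B * P.D₂₁)
  C := Matrix.fromCols ((P.C₁ + P.D₁₂ * K.D) * P.C₂) (P.D₁₂ * K.C)
  D := P.D₁₂ * K.D * P.D₂₁

/-- The closed loop from `r` to `z₂` (controller `C`, no disturbance), which depends on `C`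
only. -/
def Plant.Tz₂r (P : Plant n m₁ m₂ p₁ p₂) (C : LTI nc p₂ m₂) : LTI (n ⊕ nc) p₂ p₁ where
  A := P.loopMatrix C
  B := Matrix.fromRows (-(P.B₂ * C.D)) (-C.B)
  C := Matrix.fromCols ((P.C₁ + P.D₁₂ * C.D) * P.C₂) (P.D₁₂ * C.C)
  D := -(P.C₁ + P.D₁₂ * C.D)

end Systems

/-! ### Trajectories on `[0, ∞)` -/

/-- `x' = v` on `[0, ∞)` in the sense of Caratheodory: `x` is a continuous function that is the
integral of the locally integrable function `v`. The initial value `x 0` is arbitrary. -/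
def IsStateOf {σ : Type*} [Fintype σ] (x v : ℝ → σ → ℝ) : Prop :=
  ContinuousOn x (Set.Ici 0) ∧
    ∀ t, 0 ≤ t → IntervalIntegrable v volume 0 t ∧ x t = x 0 + ∫ s in (0 : ℝ)..t, v s

section Loops

open Matrix

variable {n m₁ m₂ p₁ p₂ nc nk nq : Type*}
  [Fintype n] [Fintype m₁] [Fintype m₂] [Fintype p₁] [Fintype p₂]
  [Fintype nc] [Fintype nk] [Fintype nq]

/-- `z` is an output of the plant with disturbance `w` and reference `r` in feedback with the
composite tracking controller made of `C`, the gain `Lc`, the observer with gain `L`, and the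
operator `Q` driven by the residual `f`. -/
def Plant.IsTrackingOutput (P : Plant n m₁ m₂ p₁ p₂) (C : LTI nc p₂ m₂)
    (L : Matrix n p₂ ℝ) (Lc : Matrix nc m₂ ℝ) (Q : LTI nq p₂ m₂)
    (w : ℝ → m₁ → ℝ) (r : ℝ → p₂ → ℝ) (z : ℝ → p₁ → ℝ) : Prop :=
  ∃ (x xhat : ℝ → n → ℝ) (xc : ℝ → nc → ℝ) (xq : ℝ → nq → ℝ) (y f : ℝ → p₂ → ℝ)
    (u uc uq : ℝ → m₂ → ℝ),
    -- the plant
    IsStateOf x (fun t => P.A *ᵥ x t + P.B₁ *ᵥ w t + P.B₂ *ᵥ u t) ∧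
    (∀ t, 0 ≤ t → y t = P.C₂ *ᵥ x t + P.D₂₁ *ᵥ w t) ∧
    -- the part of the controller that comes from `C`
    IsStateOf xc (fun t => (C.A + Lc * C.C) *ᵥ xc t - Lc *ᵥ u t
      + (C.B + Lc * C.D) *ᵥ (y t - r t)) ∧
    (∀ t, 0 ≤ t → uc t = C.C *ᵥ xc t + C.D *ᵥ (y t - r t)) ∧
    -- the observer and its residual
    IsStateOf xhat (fun t => P.A *ᵥ xhat t + P.B₂ *ᵥ u t + L *ᵥ f t) ∧
    (∀ t, 0 ≤ t → f t = P.C₂ *ᵥ xhat t - y t) ∧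
    -- the operator `Q`
    IsStateOf xq (fun t => Q.A *ᵥ xq t + Q.B *ᵥ f t) ∧
    (∀ t, 0 ≤ t → uq t = Q.C *ᵥ xq t + Q.D *ᵥ f t) ∧
    -- the control input and the performance output
    (∀ t, 0 ≤ t → u t = uc t + uq t) ∧
    (∀ t, 0 ≤ t → z t = P.C₁ *ᵥ (P.C₂ *ᵥ x t - r t) + P.D₁₂ *ᵥ u t) ∧
    (∀ t, t < 0 → z t = 0)

/-- `z₁` is an output of the plant with disturbance `w` and `r = 0` in feedback with `K`. -/
def Plant.IsRobustOutput (P : Plant n m₁ m₂ p₁ p₂) (K : LTI nk p₂ m₂)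
    (w : ℝ → m₁ → ℝ) (z₁ : ℝ → p₁ → ℝ) : Prop :=
  ∃ (x : ℝ → n → ℝ) (xk : ℝ → nk → ℝ) (y : ℝ → p₂ → ℝ) (u : ℝ → m₂ → ℝ),
    IsStateOf x (fun t => P.A *ᵥ x t + P.B₁ *ᵥ w t + P.B₂ *ᵥ u t) ∧
    (∀ t, 0 ≤ t → y t = P.C₂ *ᵥ x t + P.D₂₁ *ᵥ w t) ∧
    IsStateOf xk (fun t => K.A *ᵥ xk t + K.B *ᵥ y t) ∧
    (∀ t, 0 ≤ t → u t = K.C *ᵥ xk t + K.D *ᵥ y t) ∧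
    (∀ t, 0 ≤ t → z₁ t = P.C₁ *ᵥ (P.C₂ *ᵥ x t) + P.D₁₂ *ᵥ u t) ∧
    (∀ t, t < 0 → z₁ t = 0)

/-- `z₂` is an output of the plant with `w = 0` and reference `r` in feedback with the tracking
controller `C` driven by `y - r`. -/
def Plant.IsNominalOutput (P : Plant n m₁ m₂ p₁ p₂) (C : LTI nc p₂ m₂)
    (r : ℝ → p₂ → ℝ) (z₂ : ℝ → p₁ → ℝ) : Prop :=
  ∃ (x : ℝ → n → ℝ) (xc : ℝ → nc → ℝ) (y : ℝ → p₂ → ℝ) (u : ℝ → m₂ → ℝ),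
    IsStateOf x (fun t => P.A *ᵥ x t + P.B₂ *ᵥ u t) ∧
    (∀ t, 0 ≤ t → y t = P.C₂ *ᵥ x t) ∧
    IsStateOf xc (fun t => C.A *ᵥ xc t + C.B *ᵥ (y t - r t)) ∧
    (∀ t, 0 ≤ t → u t = C.C *ᵥ xc t + C.D *ᵥ (y t - r t)) ∧
    (∀ t, 0 ≤ t → z₂ t = P.C₁ *ᵥ (P.C₂ *ᵥ x t - r t) + P.D₁₂ *ᵥ u t) ∧
    (∀ t, t < 0 → z₂ t = 0)

end Loops

/-! ### Bounded power signals -/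

section Signals

variable {ι κ : Type*}

/-- `R τ = lim_{T → ∞} (1/T) ∫_0^T u(t+τ) v(t)' dt` for every real `τ` (the limit exists). -/
def HasCrossCorrelation (u : ℝ → ι → ℝ) (v : ℝ → κ → ℝ) (R : ℝ → Matrix ι κ ℝ) : Prop :=
  ∀ τ i j, Tendsto (fun T : ℝ => T⁻¹ * ∫ t in (0 : ℝ)..T, u (t + τ) i * v t j)
    atTop (𝓝 (R τ i j))

/-- `R` and `S dμ` form a Fourier transform pair:
`R τ = (1/2π) ∫ e^{jωτ} S(jω) dμ(ω)` for every real `τ`, with `S` integrable.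
For `μ` the Lebesgue measure, `S` is a spectral density in the usual sense; other reference
measures `μ` (for instance with atoms) allow spectral densities with impulses, such as those
of sinusoids. The value `S ω` is written for `S(jω)`. -/
def IsSpectralDensity (R : ℝ → Matrix ι κ ℝ) (μ : Measure ℝ) (S : ℝ → Matrix ι κ ℂ) : Prop :=
  SigmaFinite μ ∧ (∀ i j, Integrable (fun ω => S ω i j) μ) ∧
    ∀ τ i j, (R τ i j : ℂ) =
      (1 / (2 * Real.pi) : ℂ) * ∫ ω, Complex.exp (Complex.I * ω * τ) * S ω i j ∂μ

/-- The cross-correlation of `u` and `v` exists and has the spectral density `S` (relative to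
`μ`). -/
def HasCrossSpectralDensity (u : ℝ → ι → ℝ) (v : ℝ → κ → ℝ)
    (μ : Measure ℝ) (S : ℝ → Matrix ι κ ℂ) : Prop :=
  ∃ R, HasCrossCorrelation u v R ∧ IsSpectralDensity R μ S

/-- Two signals are orthogonal: their cross spectral density is zero. -/
def IsOrthogonal (u : ℝ → ι → ℝ) (v : ℝ → κ → ℝ) : Prop :=
  HasCrossSpectralDensity u v volume (fun _ => 0)

/-- The average `(1/T) ∫_0^T ‖u(t)‖² dt` (Euclidean norm). -/
def averagePower [Fintype ι] (u : ℝ → ι → ℝ) (T : ℝ) : ℝ :=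
  T⁻¹ * ∫ t in (0 : ℝ)..T, ∑ i, u t i ^ 2

/-- Bounded power signals. -/
structure BoundedPower [Fintype ι] (u : ℝ → ι → ℝ) : Prop where
  measurable : AEStronglyMeasurable u volume
  zero_of_neg : ∀ t, t < 0 → u t = 0
  bounded : ∃ M, ∀ t, 0 ≤ t → ‖u t‖ ≤ M
  spectrum : ∃ μ S, HasCrossSpectralDensity u u μ S
  power : ∃ p, Tendsto (averagePower u) atTop (𝓝 p)

/-- The power seminorm `‖u‖_P`, meaningful when the limit exists. -/
def powerNorm [Fintype ι] (u : ℝ → ι → ℝ) : ℝ :=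
  Real.sqrt (limUnder atTop (averagePower u))

end Signals

/-- The integrand `Trace[T(jω) S(jω) T(jω)^*]`. -/
def traceIntegrand {σ ι ο : Type*} [Fintype σ] [DecidableEq σ] [Fintype ι] [Fintype ο]
    (G : LTI σ ι ο) (S : ℝ → Matrix ι ι ℂ) (ω : ℝ) : ℂ :=
  (G.transfer (Complex.I * ω) * S ω * (G.transfer (Complex.I * ω)).conjTranspose).trace

end MOCC

end

/-! Two facts carry the theorem: an exact algebraic splitting of the tracking loop, and the rule
that a stable system turns a spectral density S into T S T*.

Splitting. With f = C₂x̂ - y, put x₁ = x - x̂ + q₂ and x₂ = x̂ - q₂, where (q₁, q₂, q₃) is the state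
of Q. The terms in L cancel in x₁, and C₂q₂ - f = C₂x₁ + D₂₁w, so (x₁, q₃) is a trajectory of the
plant with disturbance w in feedback with K. The terms in Lc cancel in xc - q₁, so (x₂, xc - q₁) is
a trajectory of the nominal loop driven by r. Inputs and outputs add, hence z = ζ₁ + ζ₂
(`Plant.IsTrackingOutput.exists_eq_add`).

Spectra. A Hurwitz system responds with an exponentially small transient plus a convolution with an
integrable impulse response plus a feedthrough term (`LTI.IsOutput.exists_eq`). The transient is
invisible to time averages, and correlations pass through the convolution by dominated convergence
(`HasCorrelation.conv`). On the spectral side the convolution becomes multiplication by the transfer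
matrix, which is the Fourier transform of the impulse response (`LTI.transfer_apply`). Applying this
to each argument gives G S H* (`LTI.IsOutput.hasCrossSpectralDensity`).

Conclusion. The cross density of ζ₁ and ζ₂ is T₁ S_wr T₂* = 0, so the powers add. Each power is an
integral that does not see the initial state, so ζ₁, ζ₂ may be replaced by the given z₁, z₂. -/

namespace MOCC

/-! ### Exponential decay of `exp (t M)` for Hurwitz `M`. -/

section MatrixExponential

open scoped Matrix.Norms.Operator
open Matrix

variable {σ : Type*} [Fintype σ] [DecidableEq σ]

theorem exp_mulVec_of_mulVec_eq {N : Matrix σ σ ℂ} {μ : ℂ} {v : σ → ℂ}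
    (h : N *ᵥ v = μ • v) : NormedSpace.exp N *ᵥ v = Complex.exp μ • v := by
  have hpow : ∀ k : ℕ, (N ^ k) *ᵥ v = μ ^ k • v := by
    intro k
    induction k with
    | zero => simp
    | succ k ih => rw [pow_succ, ← mulVec_mulVec, h, mulVec_smul, ih, smul_smul, pow_succ']
  let l : Matrix σ σ ℂ →ₗ[ℂ] (σ → ℂ) :=
    { toFun := fun X => X *ᵥ v
      map_add' := fun X Y => add_mulVec X Y v
      map_smul' := fun c X => smul_mulVec c X v }
  have h1 := (NormedSpace.exp_series_hasSum_exp' (𝕂 := ℂ) N).mapL l.toContinuousLinearMap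
  have h2 := (NormedSpace.exp_series_hasSum_exp' (𝕂 := ℂ) μ).smul_const v
  refine (h1.unique ?_).trans (by rw [Complex.exp_eq_exp_ℂ])
  convert! h2 using 2 with k
  change ((k.factorial : ℂ)⁻¹ • N ^ k) *ᵥ v = _
  rw [smul_mulVec, hpow, smul_assoc]

/-- Since N commutes with exp N, it preserves each eigenspace of exp N. Over ℂ it has an eigenvector
there, and on that vector exp N acts both as c and as exp μ. -/
theorem exists_mem_spectrum_of_mem_spectrum_exp {N : Matrix σ σ ℂ} {c : ℂ}
    (hc : c ∈ spectrum ℂ (NormedSpace.exp N)) : ∃ μ ∈ spectrum ℂ N, c = Complex.exp μ := by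
  set f : Module.End ℂ (σ → ℂ) := toLin' N
  set g : Module.End ℂ (σ → ℂ) := toLin' (NormedSpace.exp N)
  have hg : g.HasEigenvalue c := by
    rw [Module.End.hasEigenvalue_iff_mem_spectrum, spectrum_toLin']
    exact hc
  have hcomm : Commute g f := by
    have h : Commute (NormedSpace.exp N) N := (Commute.refl N).exp_left
    change g * f = f * g
    rw [Module.End.mul_eq_comp, Module.End.mul_eq_comp, ← toLin'_mul, ← toLin'_mul, h.eq]
  have hmaps : ∀ x ∈ g.eigenspace c, f x ∈ g.eigenspace c :=
    Module.End.mapsTo_genEigenspace_of_comm hcomm c 1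
  have : Nontrivial (g.eigenspace c) := Submodule.nontrivial_iff_ne_bot.2 hg
  obtain ⟨μ, hμ⟩ := Module.End.exists_eigenvalue (f.restrict hmaps)
  obtain ⟨v, hv⟩ := hμ.exists_hasEigenvector
  have hv1 : f v = μ • (v : σ → ℂ) := congrArg Subtype.val hv.apply_eq_smul
  have hv0 : (v : σ → ℂ) ≠ 0 := fun h => hv.2 (Subtype.ext h)
  refine ⟨μ, ?_, ?_⟩
  · rw [← spectrum_toLin', ← Module.End.hasEigenvalue_iff_mem_spectrum]
    exact Module.End.hasEigenvalue_of_hasEigenvector ⟨Module.End.mem_eigenspace_iff.2 hv1, hv0⟩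
  · have h1 : g v = c • (v : σ → ℂ) := Module.End.mem_eigenspace_iff.1 v.2
    have h2 : g v = Complex.exp μ • (v : σ → ℂ) := by
      rw [toLin'_apply]
      exact exp_mulVec_of_mulVec_eq (by rw [← toLin'_apply]; exact hv1)
    have h3 : (c - Complex.exp μ) • (v : σ → ℂ) = 0 := by rw [sub_smul, ← h1, ← h2, sub_self]
    exact sub_eq_zero.1 ((smul_eq_zero.1 h3).resolve_right hv0)

/-- The eigenvalues exp μ of exp N have modulus exp(Re μ) < 1, so the spectral radius is below 1.
Gelfand's formula then makes some power a strict contraction. -/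
theorem exists_norm_exp_nsmul_lt_one {N : Matrix σ σ ℂ} (hN : ∀ s ∈ spectrum ℂ N, s.re < 0) :
    ∃ k : ℕ, 0 < k ∧ ‖NormedSpace.exp ((k : ℝ) • N)‖ < 1 := by
  rcases isEmpty_or_nonempty σ with hσ | hσ
  · refine ⟨1, one_pos, ?_⟩
    rw [Subsingleton.elim (NormedSpace.exp (((1 : ℕ) : ℝ) • N)) 0, norm_zero]
    exact one_pos
  have hr : spectralRadius ℂ (NormedSpace.exp N) < ((1 : NNReal) : ENNReal) := by
    refine spectrum.spectralRadius_lt_of_forall_lt _ fun z hz => ?_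
    obtain ⟨μ, hμ, rfl⟩ := exists_mem_spectrum_of_mem_spectrum_exp hz
    rw [← NNReal.coe_lt_coe, coe_nnnorm, Complex.norm_exp, NNReal.coe_one, Real.exp_lt_one_iff]
    exact hN μ hμ
  have h := spectrum.pow_nnnorm_pow_one_div_tendsto_nhds_spectralRadius (NormedSpace.exp N)
  obtain ⟨k, hk, hk0⟩ := ((h.eventually_lt_const hr).and (eventually_gt_atTop 0)).exists
  refine ⟨k, hk0, ?_⟩
  have hk' : ((‖NormedSpace.exp N ^ k‖₊ : NNReal) : ENNReal) < 1 := by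
    by_contra! hcon
    have hpos : (0 : ℝ) < 1 / k := by positivity
    exact absurd (ENNReal.one_le_rpow hcon hpos) (not_le.2 (by simpa using hk))
  have hE : NormedSpace.exp ((k : ℝ) • N) = NormedSpace.exp N ^ k := by
    rw [← Matrix.exp_nsmul, Nat.cast_smul_eq_nsmul]
  rw [hE]
  exact_mod_cast hk'

/-- A semigroup that contracts over one period k decays geometrically over multiples of k; the
remaining time lies in the compact interval [0, k], where the norm is bounded. -/
theorem exists_norm_exp_smul_le {N : Matrix σ σ ℂ} (hN : ∀ s ∈ spectrum ℂ N, s.re < 0) :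
    ∃ c δ : ℝ, 0 < δ ∧ ∀ t : ℝ, 0 ≤ t → ‖NormedSpace.exp (t • N)‖ ≤ c * Real.exp (-δ * t) := by
  obtain ⟨k, hk, hlt⟩ := exists_norm_exp_nsmul_lt_one hN
  set φ : ℝ → Matrix σ σ ℂ := fun t => NormedSpace.exp (t • N)
  have hφ : Continuous φ := by
    refine continuous_iff_continuousAt.2 fun t => ?_
    exact (hasDerivAt_exp_smul_const N t).continuousAt
  have hkpos : (0 : ℝ) < k := by exact_mod_cast hk
  -- The contraction factor is enlarged to a positive q < 1 so that log q is usable even if the norm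
  -- is zero.
  obtain ⟨q, hq, hq1⟩ := exists_between (max_lt hlt one_pos)
  have hφk : ‖φ k‖ ≤ q := (le_max_left _ _).trans hq.le
  have hq0 : 0 < q := (le_max_right ‖φ k‖ 0).trans_lt hq
  have hstep : ∀ (j : ℕ) (s : ℝ), ‖φ (s + j * k)‖ ≤ q ^ j * ‖φ s‖ := by
    intro j s
    induction j with
    | zero => simp
    | succ j ih =>
      have hadd : φ (s + (j + 1 : ℕ) * k) = φ k * φ (s + j * k) := by
        simp only [φ]
        rw [← Matrix.exp_add_of_commute _ _
          (((Commute.refl N).smul_left _).smul_right _), ← add_smul]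
        congr 2
        push_cast
        ring
      calc ‖φ (s + (j + 1 : ℕ) * k)‖ ≤ ‖φ k‖ * ‖φ (s + j * k)‖ := hadd ▸ norm_mul_le _ _
        _ ≤ q * (q ^ j * ‖φ s‖) := by gcongr
        _ = q ^ (j + 1) * ‖φ s‖ := by ring
  obtain ⟨b, hb⟩ := (isCompact_Icc (a := (0 : ℝ)) (b := k)).exists_bound_of_continuousOn
    hφ.continuousOn
  have hb0 : 0 ≤ b := (norm_nonneg _).trans (hb 0 ⟨le_rfl, hkpos.le⟩)
  -- The rate is chosen so that exp(-δt) = q^(t/k). The factor q⁻¹ pays for the floor: j + 1 ≥ t/k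
  -- gives q^j ≤ q⁻¹ q^(t/k).
  refine ⟨q⁻¹ * b, -Real.log q / k, div_pos (neg_pos.2 (Real.log_neg hq0 hq1)) hkpos,
    fun t ht => ?_⟩
  set j := ⌊t / k⌋₊
  have hj1 : (j : ℝ) * k ≤ t := by
    rw [← le_div_iff₀ hkpos]
    exact Nat.floor_le (by positivity)
  have hj2 : t < (j + 1 : ℝ) * k := by
    rw [← div_lt_iff₀ hkpos]
    exact Nat.lt_floor_add_one _
  have h1 := hstep j (t - j * k)
  rw [sub_add_cancel] at h1
  have h2 : q ^ j ≤ q⁻¹ * Real.exp (-(-Real.log q / k) * t) := by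
    rw [← div_eq_inv_mul, le_div_iff₀ hq0, ← pow_succ, ← Real.exp_log (pow_pos hq0 (j + 1)),
      Real.exp_le_exp, Real.log_pow]
    have h3 : t / k ≤ ((j + 1 : ℕ) : ℝ) := by
      rw [div_le_iff₀ hkpos]
      push_cast
      exact hj2.le
    calc ((j + 1 : ℕ) : ℝ) * Real.log q ≤ t / k * Real.log q :=
          mul_le_mul_of_nonpos_right h3 (Real.log_neg hq0 hq1).le
      _ = -(-Real.log q / k) * t := by ring
  calc ‖φ t‖ ≤ q ^ j * ‖φ (t - j * k)‖ := h1
    _ ≤ (q⁻¹ * Real.exp (-(-Real.log q / k) * t)) * b := by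
        gcongr
        exact hb _ ⟨by linarith, by linarith⟩
    _ = q⁻¹ * b * Real.exp (-(-Real.log q / k) * t) := by ring

theorem map_ofReal_exp (M : Matrix σ σ ℝ) :
    (NormedSpace.exp M).map Complex.ofReal = NormedSpace.exp (M.map Complex.ofReal) :=
  NormedSpace.map_exp (Complex.ofRealHom.mapMatrix (m := σ))
    (Continuous.matrix_map continuous_id Complex.continuous_ofReal) M

theorem hasDerivAt_exp_smul_apply (M : Matrix σ σ ℝ) (t : ℝ) (i j : σ) :
    HasDerivAt (fun t : ℝ => NormedSpace.exp (t • M) i j) ((NormedSpace.exp (t • M) * M) i j) t := by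
  have h := (entryLinearMap ℝ ℝ i j).toContinuousLinearMap.hasFDerivAt.comp_hasDerivAt t
    (hasDerivAt_exp_smul_const M t)
  exact h

theorem IsHurwitz.exists_abs_exp_smul_le {M : Matrix σ σ ℝ} (hM : IsHurwitz M) :
    ∃ c δ : ℝ, 0 < δ ∧ ∀ t : ℝ, 0 ≤ t → ∀ i j,
      |NormedSpace.exp (t • M) i j| ≤ c * Real.exp (-δ * t) := by
  obtain ⟨c, δ, hδ, h⟩ := exists_norm_exp_smul_le hM
  refine ⟨c, δ, hδ, fun t ht i j => ?_⟩
  have hmap : (t • M).map Complex.ofReal = t • M.map Complex.ofReal := by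
    ext a b
    simp
  have hentry : ((NormedSpace.exp (t • M) i j : ℝ) : ℂ)
      = NormedSpace.exp (t • M.map Complex.ofReal) i j := by
    rw [← hmap, ← map_ofReal_exp, map_apply]
  rw [← Real.norm_eq_abs, ← Complex.norm_real, hentry]
  refine le_trans ?_ (h t ht)
  generalize NormedSpace.exp (t • M.map Complex.ofReal) = E
  -- The operator norm in use is the largest absolute row sum, which dominates every entry.
  rw [← coe_nnnorm, linfty_opNorm_def, NNReal.coe_le_coe]
  exact (Finset.single_le_sum (f := fun j => ‖E i j‖₊) (fun _ _ => zero_le) (Finset.mem_univ j)).trans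
    (Finset.le_sup (f := fun i => ∑ j, ‖E i j‖₊) (Finset.mem_univ i))

end MatrixExponential

/-! ### The resolvent on the imaginary axis as a Fourier transform. -/

section Resolvent

open Matrix

variable {σ : Type*} [Fintype σ] [DecidableEq σ]

theorem continuous_exp_smul_apply (M : Matrix σ σ ℝ) (i j : σ) :
    Continuous fun t : ℝ => NormedSpace.exp (t • M) i j :=
  continuous_iff_continuousAt.2 fun t => (hasDerivAt_exp_smul_apply M t i j).continuousAt

theorem IsHurwitz.integrableOn_exp_smul {M : Matrix σ σ ℝ} (hM : IsHurwitz M) (i j : σ) :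
    IntegrableOn (fun t : ℝ => NormedSpace.exp (t • M) i j) (Set.Ioi 0) := by
  obtain ⟨c, δ, hδ, h⟩ := hM.exists_abs_exp_smul_le
  refine Integrable.mono' ((exp_neg_integrableOn_Ioi 0 hδ).const_mul c)
    (continuous_exp_smul_apply M i j).aestronglyMeasurable ?_
  filter_upwards [ae_restrict_mem measurableSet_Ioi] with t ht
  exact h t (le_of_lt ht) i j

theorem IsHurwitz.tendsto_exp_smul {M : Matrix σ σ ℝ} (hM : IsHurwitz M) (i j : σ) :
    Tendsto (fun t : ℝ => NormedSpace.exp (t • M) i j) atTop (𝓝 0) := by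
  obtain ⟨c, δ, hδ, h⟩ := hM.exists_abs_exp_smul_le
  refine squeeze_zero_norm' ((eventually_ge_atTop 0).mono fun t ht => h t ht i j) ?_
  have h1 : Tendsto (fun t : ℝ => Real.exp (-δ * t)) atTop (𝓝 0) :=
    Real.tendsto_exp_atBot.comp ((tendsto_const_mul_atBot_of_neg (by linarith)).2 tendsto_id)
  simpa using h1.const_mul c

theorem norm_exp_neg_I_mul (ω s : ℝ) : ‖Complex.exp (-(Complex.I * ω * s))‖ = 1 := by
  rw [show -(Complex.I * ω * s) = ((-(ω * s) : ℝ) : ℂ) * Complex.I by push_cast; ring,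
    Complex.norm_exp_ofReal_mul_I]

theorem integrable_exp_neg_I_mul {μ : Measure ℝ} {g : ℝ → ℝ} (hg : Integrable g μ) (ω : ℝ) :
    Integrable (fun s : ℝ => Complex.exp (-(Complex.I * ω * s)) * (g s : ℂ)) μ := by
  refine (hg.ofReal (𝕜 := ℂ)).bdd_mul (c := 1) (by fun_prop) ?_
  filter_upwards with s
  exact (norm_exp_neg_I_mul ω s).le

/-- The resolvent of a Hurwitz matrix on the imaginary axis is the Fourier transform of its
exponential. -/
theorem IsHurwitz.inv_scalar_sub {M : Matrix σ σ ℝ} (hM : IsHurwitz M) (ω : ℝ) :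
    (scalar σ (Complex.I * ω) - M.map Complex.ofReal)⁻¹ =
      of fun i j => ∫ s in Set.Ioi (0 : ℝ),
        Complex.exp (-(Complex.I * ω * s)) * (NormedSpace.exp (s • M) i j : ℂ) := by
  have hint := fun i j => integrable_exp_neg_I_mul (hM.integrableOn_exp_smul i j) ω
  apply inv_eq_left_inv
  rw [mul_sub]
  ext i j
  have hmul : ∀ s : ℝ, (((NormedSpace.exp (s • M) * M) i j : ℝ) : ℂ) =
      ∑ k, (NormedSpace.exp (s • M) i k : ℂ) * M k j := by
    intro s
    rw [mul_apply]
    push_cast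
    rfl
  -- The derivative of e^{-iωs} e^{sM} is e^{-iωs} e^{sM} (M - iω). Integrating over the half-line,
  -- with limit 0 at infinity and value 1 at 0, yields the left-inverse identity.
  have hder : ∀ s ∈ Set.Ici (0 : ℝ), HasDerivAt
      (fun s : ℝ => Complex.exp (-(Complex.I * ω * s)) * (NormedSpace.exp (s • M) i j : ℂ))
      (-(Complex.I * ω) * (Complex.exp (-(Complex.I * ω * s)) * (NormedSpace.exp (s • M) i j : ℂ))
        + ∑ k, (Complex.exp (-(Complex.I * ω * s)) * (NormedSpace.exp (s • M) i k : ℂ)) * M k j)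
      s := by
    intro s _
    have h1 : HasDerivAt (fun s : ℝ => Complex.exp (-(Complex.I * ω * s)))
        (Complex.exp (-(Complex.I * ω * s)) * -(Complex.I * ω)) s := by
      have h0 : HasDerivAt (fun s : ℝ => -(Complex.I * ω * (s : ℂ))) (-(Complex.I * ω)) s := by
        simpa [neg_mul] using (Complex.ofRealCLM.hasDerivAt (x := s)).const_mul (-(Complex.I * ω))
      exact h0.cexp
    have h2 := h1.mul (hasDerivAt_exp_smul_apply M s i j).ofReal_comp
    refine h2.congr_deriv ?_
    rw [hmul, Finset.mul_sum]
    congr 1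
    · ring
    · exact Finset.sum_congr rfl fun k _ => by ring
  have htend : Tendsto
      (fun s : ℝ => Complex.exp (-(Complex.I * ω * s)) * (NormedSpace.exp (s • M) i j : ℂ))
      atTop (𝓝 0) := by
    rw [tendsto_zero_iff_norm_tendsto_zero]
    simp only [norm_mul, norm_exp_neg_I_mul, one_mul, Complex.norm_real]
    exact tendsto_zero_iff_norm_tendsto_zero.1 (hM.tendsto_exp_smul i j)
  have hsum : Integrable (fun s : ℝ => ∑ k,
      (Complex.exp (-(Complex.I * ω * s)) * (NormedSpace.exp (s • M) i k : ℂ)) * M k j)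
      (volume.restrict (Set.Ioi 0)) :=
    integrable_finsetSum _ fun k _ => (hint i k).mul_const _
  have h := integral_Ioi_of_hasDerivAt_of_tendsto' hder
    (((hint i j).const_mul (-(Complex.I * ω))).add hsum) htend
  rw [integral_add ((hint i j).const_mul (-(Complex.I * ω))) hsum, integral_const_mul,
    integral_finsetSum _ (fun k _ => (hint i k).mul_const _)] at h
  simp only [integral_mul_const] at h
  rw [Matrix.sub_apply, mul_apply, mul_apply]
  simp only [of_apply, scalar_apply, diagonal_apply, map_apply, mul_ite, mul_zero,
    Finset.sum_ite_eq', Finset.mem_univ, if_true]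
  have h0 : (Complex.exp (-(Complex.I * ω * (0 : ℝ))) * (NormedSpace.exp ((0 : ℝ) • M) i j : ℂ))
      = (1 : Matrix σ σ ℂ) i j := by
    rw [zero_smul, NormedSpace.exp_zero]
    by_cases hij : i = j <;> simp [one_apply, hij]
  rw [h0, zero_sub] at h
  rw [← neg_eq_iff_eq_neg] at h
  rw [← h]
  ring

end Resolvent

open Matrix

/-- Integration by parts for Caratheodory trajectories: X is only a primitive of an integrable
function, so its derivative is v merely almost everywhere, and the absolutely continuous version of
the rule is required. -/
theorem integral_mul_eq_sub_of_primitive {f f' v X : ℝ → ℝ} {t : ℝ} (ht : 0 ≤ t)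
    (hf : ∀ s, HasDerivAt f (f' s) s) (hf' : Continuous f')
    (hv : IntervalIntegrable v volume 0 t)
    (hX : ∀ s, 0 ≤ s → s ≤ t → X s = X 0 + ∫ r in (0 : ℝ)..s, v r) :
    ∫ s in (0 : ℝ)..t, f s * v s = f t * X t - f 0 * X 0 - ∫ s in (0 : ℝ)..t, f' s * X s := by
  have hderiv : deriv f = f' := funext fun s => (hf s).deriv
  have hfac : AbsolutelyContinuousOnInterval f 0 t := by
    refine ContDiffOn.absolutelyContinuousOnInterval (ContDiff.contDiffOn ?_)
    rw [contDiff_one_iff_deriv, hderiv]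
    exact ⟨fun s => (hf s).differentiableAt, hf'⟩
  have hYac : AbsolutelyContinuousOnInterval (fun s => X 0 + ∫ r in (0 : ℝ)..s, v r) 0 t :=
    (contDiffOn_const.absolutelyContinuousOnInterval (f := fun _ => X 0)).fun_add
      (hv.absolutelyContinuousOnInterval_intervalIntegral (by simp))
  have h := hfac.integral_mul_deriv_eq_deriv_mul hYac
  have h1 : ∫ s in (0 : ℝ)..t, f s * deriv (fun s => X 0 + ∫ r in (0 : ℝ)..s, v r) s
      = ∫ s in (0 : ℝ)..t, f s * v s := by
    refine intervalIntegral.integral_congr_ae ?_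
    filter_upwards [hv.ae_hasDerivAt_integral] with s hs hst
    rw [((hs (Set.uIoc_subset_uIcc hst) 0 (by simp)).const_add (X 0)).deriv]
  have h2 : ∫ s in (0 : ℝ)..t, deriv f s * (X 0 + ∫ r in (0 : ℝ)..s, v r)
      = ∫ s in (0 : ℝ)..t, f' s * X s := by
    refine intervalIntegral.integral_congr fun s hs => ?_
    rw [Set.uIcc_of_le ht] at hs
    simp only [hderiv, hX s hs.1 hs.2]
  rw [h1, h2] at h
  rw [h, ← hX t ht le_rfl]
  simp

/-! ### Variation of constants and the impulse-response representation. -/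

section StateSpace

variable {σ ι ο : Type*} [Fintype σ]

theorem IsStateOf.intervalIntegrable_apply {x v : ℝ → σ → ℝ} (h : IsStateOf x v) {t : ℝ}
    (ht : 0 ≤ t) (j : σ) : IntervalIntegrable (fun s => v s j) volume 0 t :=
  ⟨(h.2 t ht).1.1.eval j, (h.2 t ht).1.2.eval j⟩

theorem IsStateOf.apply_eq {x v : ℝ → σ → ℝ} (h : IsStateOf x v) {t : ℝ} (ht : 0 ≤ t) (j : σ) :
    x t j = x 0 j + ∫ s in (0 : ℝ)..t, v s j := by
  have h1 := (ContinuousLinearMap.proj (R := ℝ) (φ := fun _ : σ => ℝ) j).intervalIntegral_comp_comm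
    (h.2 t ht).1
  have h2 := congrFun (h.2 t ht).2 j
  rw [h2, Pi.add_apply]
  exact congrArg _ h1.symm

theorem IsStateOf.continuousOn_apply {x v : ℝ → σ → ℝ} (h : IsStateOf x v) {t : ℝ} (ht : 0 ≤ t)
    (j : σ) : ContinuousOn (fun s => x s j) (Set.uIcc 0 t) := by
  rw [Set.uIcc_of_le ht]
  exact (continuousOn_pi.1 h.1 j).mono Set.Icc_subset_Ici_self

variable [DecidableEq σ]

/-- Variation of constants. -/
theorem IsStateOf.eq_exp_add_integral {M : Matrix σ σ ℝ} {x v : ℝ → σ → ℝ}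
    (h : IsStateOf x (fun t => M *ᵥ x t + v t)) {t : ℝ} (ht : 0 ≤ t) (i : σ) :
    (∀ j, IntervalIntegrable (fun s => NormedSpace.exp ((t - s) • M) i j * v s j) volume 0 t) ∧
    x t i = (NormedSpace.exp (t • M) *ᵥ x 0) i +
      ∑ j, ∫ s in (0 : ℝ)..t, NormedSpace.exp ((t - s) • M) i j * v s j := by
  have hder : ∀ j s, HasDerivAt (fun s => NormedSpace.exp ((t - s) • M) i j)
      (-(NormedSpace.exp ((t - s) • M) * M) i j) s := by
    intro j s
    have h1 := (hasDerivAt_exp_smul_apply M (t - s) i j).scomp s ((hasDerivAt_id s).const_sub t)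
    exact h1.congr_deriv (by simp)
  have hΦ : ∀ j, Continuous fun s => NormedSpace.exp ((t - s) • M) i j := fun j =>
    (continuous_exp_smul_apply M i j).comp (continuous_const.sub continuous_id)
  have hΦM : ∀ j, Continuous fun s => (NormedSpace.exp ((t - s) • M) * M) i j := by
    intro j
    simp only [mul_apply]
    exact continuous_finsetSum _ fun k _ => (hΦ k).mul continuous_const
  have hMx : ∀ j, ContinuousOn (fun s => (M *ᵥ x s) j) (Set.uIcc 0 t) := by
    intro j
    simp only [mulVec, dotProduct]
    exact continuousOn_finsetSum _ fun k _ => continuousOn_const.mul (h.continuousOn_apply ht k)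
  -- Only Mx + v is known to be integrable; subtracting the continuous term Mx isolates the forcing.
  have hv : ∀ j, IntervalIntegrable (fun s => v s j) volume 0 t := by
    intro j
    have := (h.intervalIntegrable_apply ht j).sub (hMx j).intervalIntegrable
    refine this.congr fun s _ => ?_
    simp
  have hint : ∀ j, IntervalIntegrable (fun s => NormedSpace.exp ((t - s) • M) i j * v s j)
      volume 0 t := fun j => (hv j).continuousOn_mul (hΦ j).continuousOn
  refine ⟨hint, ?_⟩
  -- Integrating e^{(t-s)M} x'(s) by parts produces the integral of e^{(t-s)M} M x(s) on both sides.
  -- By `hswap` these cancel after summing over j, leaving only the forcing.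
  have hparts := fun j => integral_mul_eq_sub_of_primitive ht (hder j) (hΦM j).neg
    (h.intervalIntegrable_apply ht j) fun s hs _ => h.apply_eq hs j
  have hsplit : ∀ j, ∫ s in (0 : ℝ)..t, NormedSpace.exp ((t - s) • M) i j * (M *ᵥ x s + v s) j
      = (∫ s in (0 : ℝ)..t, NormedSpace.exp ((t - s) • M) i j * (M *ᵥ x s) j)
        + ∫ s in (0 : ℝ)..t, NormedSpace.exp ((t - s) • M) i j * v s j := by
    intro j
    rw [← intervalIntegral.integral_add _ (hint j)]
    · simp only [Pi.add_apply, mul_add]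
    · exact ((hΦ j).continuousOn.mul (hMx j)).intervalIntegrable
  have hswap : ∑ j, ∫ s in (0 : ℝ)..t, NormedSpace.exp ((t - s) • M) i j * (M *ᵥ x s) j
      = ∑ j, ∫ s in (0 : ℝ)..t, (NormedSpace.exp ((t - s) • M) * M) i j * x s j := by
    rw [← intervalIntegral.integral_finsetSum, ← intervalIntegral.integral_finsetSum]
    · congr 1
      ext s
      exact congrFun (mulVec_mulVec (x s) (NormedSpace.exp ((t - s) • M)) M) i
    · exact fun j _ => ((hΦM j).continuousOn.mul (h.continuousOn_apply ht j)).intervalIntegrable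
    · exact fun j _ => ((hΦ j).continuousOn.mul (hMx j)).intervalIntegrable
  have hsum := Finset.sum_congr (rfl : (Finset.univ : Finset σ) = _)
    fun j _ => (hsplit j).symm.trans (hparts j)
  simp only [neg_mul, intervalIntegral.integral_neg, sub_neg_eq_add, Finset.sum_add_distrib,
    Finset.sum_sub_distrib, sub_self, sub_zero, zero_smul, NormedSpace.exp_zero, hswap] at hsum
  have h1 : ∑ j, (1 : Matrix σ σ ℝ) i j * x t j = x t i := by
    simp [one_apply]
  rw [h1] at hsum
  change x t i = ∑ j, NormedSpace.exp (t • M) i j * x 0 j + _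
  linarith

/-- `z` is an output of the system `G` with input `u` and arbitrary initial state. -/
def LTI.IsOutput [Fintype ι] (G : LTI σ ι ο) (u : ℝ → ι → ℝ) (z : ℝ → ο → ℝ) : Prop :=
  ∃ x : ℝ → σ → ℝ, IsStateOf x (fun t => G.A *ᵥ x t + G.B *ᵥ u t) ∧
    (∀ t, 0 ≤ t → z t = G.C *ᵥ x t + G.D *ᵥ u t) ∧ ∀ t, t < 0 → z t = 0

/-- A bounded measurable scalar signal that vanishes for negative times. -/
structure IsBoundedCausal (u : ℝ → ℝ) : Prop where
  measurable : AEStronglyMeasurable u volume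
  zero_of_neg : ∀ t, t < 0 → u t = 0
  bounded : ∃ M, ∀ t, |u t| ≤ M

/-- The impulse response `C e^{At} B` of the strictly proper part of `G`. -/
noncomputable def LTI.impulse (G : LTI σ ι ο) (t : ℝ) : Matrix ο ι ℝ :=
  G.C * NormedSpace.exp (t • G.A) * G.B

theorem LTI.continuous_impulse_apply (G : LTI σ ι ο) (i : ο) (k : ι) :
    Continuous fun t => G.impulse t i k := by
  simp only [LTI.impulse, mul_apply]
  exact continuous_finsetSum _ fun j _ => (continuous_finsetSum _ fun l _ =>
    continuous_const.mul (continuous_exp_smul_apply G.A l j)).mul continuous_const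

theorem LTI.integrableOn_impulse {G : LTI σ ι ο} (hG : IsHurwitz G.A) (i : ο) (k : ι) :
    IntegrableOn (fun t => G.impulse t i k) (Set.Ioi 0) := by
  simp only [LTI.impulse, mul_apply]
  exact integrable_finsetSum _ fun j _ => (integrable_finsetSum _ fun l _ =>
    (hG.integrableOn_exp_smul l j).const_mul _).mul_const _

/-- The transfer matrix on the imaginary axis is the Fourier transform of the impulse
response. -/
theorem LTI.transfer_apply {G : LTI σ ι ο} (hG : IsHurwitz G.A) (ω : ℝ) (i : ο) (k : ι) :
    G.transfer (Complex.I * ω) i k = (∫ s in Set.Ioi (0 : ℝ),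
      Complex.exp (-(Complex.I * ω * s)) * (G.impulse s i k : ℂ)) + G.D i k := by
  rw [LTI.transfer, Matrix.add_apply, map_apply, hG.inv_scalar_sub]
  congr 1
  have hint := fun l j => integrable_exp_neg_I_mul (hG.integrableOn_exp_smul l j) ω
  have hs : ∀ s : ℝ, Complex.exp (-(Complex.I * ω * s)) * (G.impulse s i k : ℂ) =
      ∑ j, (∑ l, (G.C i l : ℂ) * (Complex.exp (-(Complex.I * ω * s)) *
        (NormedSpace.exp (s • G.A) l j : ℂ))) * (G.B j k : ℂ) := by
    intro s
    simp only [LTI.impulse, mul_apply, Complex.ofReal_sum, Complex.ofReal_mul, Finset.mul_sum,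
      Finset.sum_mul]
    exact Finset.sum_congr rfl fun j _ => Finset.sum_congr rfl fun l _ => by ring
  simp only [hs]
  rw [integral_finsetSum]
  · simp only [mul_apply, map_apply, of_apply]
    refine Finset.sum_congr rfl fun j _ => ?_
    rw [integral_mul_const, integral_finsetSum]
    · simp only [integral_const_mul]
    · exact fun l _ => (hint l j).const_mul _
  · exact fun j _ => (integrable_finsetSum _ fun l _ => (hint l j).const_mul _).mul_const _

/-- Causality of u kills the range s > t. The half-line form has a domain independent of t, which is
what Fubini and the Fourier transform need later. -/
theorem integral_Ioi_mul_sub_eq {g u : ℝ → ℝ} (hu : ∀ t, t < 0 → u t = 0) {t : ℝ} (ht : 0 ≤ t) :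
    ∫ s in Set.Ioi (0 : ℝ), g s * u (t - s) = ∫ s in (0 : ℝ)..t, g (t - s) * u s := by
  have h := intervalIntegral.integral_comp_sub_left (a := 0) (b := t)
    (fun s => g s * u (t - s)) t
  simp only [sub_sub_cancel, sub_self, sub_zero] at h
  rw [h, intervalIntegral.integral_of_le ht]
  refine setIntegral_eq_of_subset_of_forall_sdiff_eq_zero measurableSet_Ioi
    Set.Ioc_subset_Ioi_self fun s hs => ?_
  have : t < s := by
    by_contra! hst
    exact hs.2 ⟨hs.1, hst⟩
  rw [hu _ (by linarith), mul_zero]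

theorem integral_Ioi_mul_sub_eq_zero {g u : ℝ → ℝ} (hu : ∀ t, t < 0 → u t = 0) {t : ℝ}
    (ht : t < 0) : ∫ s in Set.Ioi (0 : ℝ), g s * u (t - s) = 0 := by
  refine setIntegral_eq_zero_of_forall_eq_zero fun s hs => ?_
  rw [hu _ (by have := Set.mem_Ioi.1 hs; linarith), mul_zero]

theorem IsBoundedCausal.intervalIntegrable {u : ℝ → ℝ} (hu : IsBoundedCausal u) (a b : ℝ) :
    IntervalIntegrable u volume a b := by
  obtain ⟨M, hM⟩ := hu.bounded
  exact (intervalIntegrable_const (c := M)).mono_fun hu.measurable.restrict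
    (Eventually.of_forall fun t => (hM t).trans (le_abs_self M))

/-- The effect of the initial state is isolated in the transient `a`, whose exponential decay makes
it integrable and hence negligible in every time average. -/
theorem LTI.IsOutput.exists_eq [Fintype ι] {G : LTI σ ι ο} (hG : IsHurwitz G.A)
    {u : ℝ → ι → ℝ} {z : ℝ → ο → ℝ} (hu : ∀ k, IsBoundedCausal fun t => u t k)
    (hz : G.IsOutput u z) :
    ∃ a : ο → ℝ → ℝ, (∀ i, IsBoundedCausal (a i) ∧ Integrable (a i)) ∧ ∀ t i,
      z t i = a i t + ∑ k, ((∫ s in Set.Ioi (0 : ℝ), G.impulse s i k * u (t - s) k)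
        + G.D i k * u t k) := by
  obtain ⟨x, hx, hz, hz0⟩ := hz
  set b : ο → ℝ → ℝ := fun i t => (G.C *ᵥ (NormedSpace.exp (t • G.A) *ᵥ x 0)) i
  have hb : ∀ i, Continuous (b i) := by
    intro i
    simp only [b, mulVec, dotProduct]
    exact continuous_finsetSum _ fun l _ => continuous_const.mul
      (continuous_finsetSum _ fun j _ => (continuous_exp_smul_apply G.A l j).mul continuous_const)
  obtain ⟨c, δ, hδ, hc⟩ := hG.exists_abs_exp_smul_le
  set K : ο → ℝ := fun i => ∑ l, |G.C i l| * ∑ j, c * |x 0 j|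
  have hbound : ∀ i t, 0 ≤ t →
      |b i t| ≤ K i * Real.exp (-δ * t) := by
    intro i t ht
    simp only [b, K, mulVec, dotProduct]
    rw [Finset.sum_mul]
    refine (Finset.abs_sum_le_sum_abs _ _).trans (Finset.sum_le_sum fun l _ => ?_)
    rw [abs_mul, mul_assoc]
    refine mul_le_mul_of_nonneg_left ?_ (abs_nonneg _)
    rw [Finset.sum_mul]
    refine (Finset.abs_sum_le_sum_abs _ _).trans (Finset.sum_le_sum fun j _ => ?_)
    rw [abs_mul, mul_right_comm]
    exact mul_le_mul_of_nonneg_right (hc t ht l j) (abs_nonneg _)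
  -- The free response C e^{At} x(0) is cut off at negative times, where it need not be bounded; the
  -- representation then holds for all real t.
  obtain ⟨a, ha⟩ : ∃ a : ο → ℝ → ℝ, a = fun i => (Set.Ici 0).indicator (b i) := ⟨_, rfl⟩
  have hab : ∀ i t, 0 ≤ t → a i t = b i t := fun i t ht => by
    simp only [ha]
    exact Set.indicator_of_mem (Set.mem_Ici.2 ht) _
  have ha0 : ∀ i t, t < 0 → a i t = 0 := fun i t ht => by
    simp only [ha]
    exact Set.indicator_of_notMem (by simpa using ht) _
  refine ⟨a, fun i => ⟨⟨?_, ?_, ?_⟩, ?_⟩, ?_⟩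
  · rw [ha]
    exact (hb i).aestronglyMeasurable.indicator measurableSet_Ici
  · exact ha0 i
  · refine ⟨|K i|, fun t => ?_⟩
    by_cases ht : 0 ≤ t
    · rw [hab i t ht]
      refine (hbound i t ht).trans ((le_abs_self _).trans ?_)
      rw [abs_mul, Real.abs_exp]
      exact mul_le_of_le_one_right (abs_nonneg _) (Real.exp_le_one_iff.2 (by nlinarith))
    · rw [ha0 i t (not_le.1 ht), abs_zero]
      exact abs_nonneg _
  · rw [ha]
    rw [integrable_indicator_iff measurableSet_Ici, integrableOn_Ici_iff_integrableOn_Ioi]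
    refine Integrable.mono' ((exp_neg_integrableOn_Ioi 0 hδ).const_mul
      (K i)) (hb i).aestronglyMeasurable ?_
    filter_upwards [ae_restrict_mem measurableSet_Ioi] with t ht
    exact hbound i t (le_of_lt ht)
  · intro t i
    by_cases ht : 0 ≤ t
    · rw [hab i t ht, hz t ht, Finset.sum_add_distrib, Pi.add_apply,
        ← add_assoc]
      congr 1
      have hxt : x t = NormedSpace.exp (t • G.A) *ᵥ x 0 + fun l =>
          ∑ j, ∫ s in (0 : ℝ)..t, NormedSpace.exp ((t - s) • G.A) l j * (G.B *ᵥ u s) j :=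
        funext fun l => (hx.eq_exp_add_integral ht l).2
      have hint := fun l => (hx.eq_exp_add_integral ht l).1
      rw [hxt, mulVec_add, Pi.add_apply]
      congr 1
      have h1 : ∀ k, ∫ s in Set.Ioi (0 : ℝ), G.impulse s i k * u (t - s) k =
          ∫ s in (0 : ℝ)..t, G.impulse (t - s) i k * u s k := fun k =>
        integral_Ioi_mul_sub_eq (u := fun t => u t k) (hu k).zero_of_neg ht
      simp only [h1]
      rw [← intervalIntegral.integral_finsetSum]
      · calc (G.C *ᵥ fun l => ∑ j, ∫ s in (0 : ℝ)..t,
              NormedSpace.exp ((t - s) • G.A) l j * (G.B *ᵥ u s) j) i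
            = ∑ l, G.C i l * ∑ j, ∫ s in (0 : ℝ)..t,
              NormedSpace.exp ((t - s) • G.A) l j * (G.B *ᵥ u s) j := rfl
          _ = ∑ l, ∫ s in (0 : ℝ)..t, G.C i l * ∑ j,
              NormedSpace.exp ((t - s) • G.A) l j * (G.B *ᵥ u s) j :=
            Finset.sum_congr rfl fun l _ => by
              rw [intervalIntegral.integral_const_mul,
                intervalIntegral.integral_finsetSum fun j _ => hint l j]
          _ = ∫ s in (0 : ℝ)..t, ∑ l, G.C i l * ∑ j,
              NormedSpace.exp ((t - s) • G.A) l j * (G.B *ᵥ u s) j :=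
            (intervalIntegral.integral_finsetSum fun l _ =>
              IntervalIntegrable.const_mul (by
                simpa only [Finset.sum_fn] using
                  IntervalIntegrable.sum Finset.univ fun j _ => hint l j) _).symm
          _ = ∫ s in (0 : ℝ)..t, ∑ k, G.impulse (t - s) i k * u s k := by
            refine intervalIntegral.integral_congr fun s _ => ?_
            have h2 : (G.impulse (t - s) *ᵥ u s) i =
                (G.C *ᵥ (NormedSpace.exp ((t - s) • G.A) *ᵥ (G.B *ᵥ u s))) i := by
              rw [LTI.impulse, mulVec_mulVec, mulVec_mulVec]
            exact h2.symm
      · intro k _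
        exact ((hu k).intervalIntegrable 0 t).continuousOn_mul ((G.continuous_impulse_apply i k).comp
          (continuous_const.sub continuous_id)).continuousOn
    · rw [not_le] at ht
      rw [ha0 i t ht, hz0 t ht]
      simp only [integral_Ioi_mul_sub_eq_zero (u := fun t => u t _) (hu _).zero_of_neg ht,
        (hu _).zero_of_neg t ht]
      simp

end StateSpace

/-! ### Scalar correlations -/

theorem IsBoundedCausal.add {u v : ℝ → ℝ} (hu : IsBoundedCausal u) (hv : IsBoundedCausal v) :
    IsBoundedCausal fun t => u t + v t := by
  obtain ⟨M, hM⟩ := hu.bounded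
  obtain ⟨N, hN⟩ := hv.bounded
  exact ⟨hu.measurable.add hv.measurable,
    fun t ht => by rw [hu.zero_of_neg t ht, hv.zero_of_neg t ht, add_zero],
    M + N, fun t => (abs_add_le _ _).trans (add_le_add (hM t) (hN t))⟩

theorem IsBoundedCausal.const_mul {u : ℝ → ℝ} (hu : IsBoundedCausal u) (c : ℝ) :
    IsBoundedCausal fun t => c * u t := by
  obtain ⟨M, hM⟩ := hu.bounded
  exact ⟨hu.measurable.const_mul c, fun t ht => by rw [hu.zero_of_neg t ht, mul_zero],
    |c| * M, fun t => by
      rw [abs_mul]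
      exact mul_le_mul_of_nonneg_left (hM t) (abs_nonneg c)⟩

theorem IsBoundedCausal.finsetSum {ι : Type*} (s : Finset ι) {u : ι → ℝ → ℝ}
    (hu : ∀ k, IsBoundedCausal (u k)) : IsBoundedCausal fun t => ∑ k ∈ s, u k t := by
  induction s using Finset.cons_induction with
  | empty => exact ⟨by simpa using aestronglyMeasurable_const, by simp, 0, by simp⟩
  | cons a s ha ih => simpa only [Finset.sum_cons] using (hu a).add ih

theorem IsBoundedCausal.aestronglyMeasurable_sub {u : ℝ → ℝ} (hu : IsBoundedCausal u)
    (s : Set ℝ) : AEStronglyMeasurable (fun p : ℝ × ℝ => u (p.1 - p.2))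
      ((volume : Measure ℝ).prod (volume.restrict s)) :=
  hu.measurable.comp_quasiMeasurePreserving
    (quasiMeasurePreserving_sub_of_right_invariant volume (volume.restrict s))

theorem IsBoundedCausal.conv {g u : ℝ → ℝ} (hu : IsBoundedCausal u)
    (hg : IntegrableOn g (Set.Ioi 0)) :
    IsBoundedCausal fun t => ∫ s in Set.Ioi (0 : ℝ), g s * u (t - s) := by
  obtain ⟨M, hM⟩ := hu.bounded
  refine ⟨?_, fun t ht => integral_Ioi_mul_sub_eq_zero hu.zero_of_neg ht,
    ∫ s in Set.Ioi (0 : ℝ), |g s| * M, fun t => ?_⟩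
  · exact AEStronglyMeasurable.integral_prod_right' (f := fun p : ℝ × ℝ => g p.2 * u (p.1 - p.2))
      ((hg.aestronglyMeasurable.comp_snd).mul (hu.aestronglyMeasurable_sub _))
  · rw [← Real.norm_eq_abs]
    refine norm_integral_le_of_norm_le (hg.abs.mul_const M) (Eventually.of_forall fun s => ?_)
    rw [norm_mul]
    exact mul_le_mul_of_nonneg_left (hM _) (norm_nonneg _)

theorem IsBoundedCausal.measurable_shift {u : ℝ → ℝ} (hu : IsBoundedCausal u) (τ : ℝ) :
    AEStronglyMeasurable (fun t => u (t + τ)) volume :=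
  hu.measurable.comp_measurePreserving (measurePreserving_add_right volume τ)

theorem IsBoundedCausal.exists_mul_bound {u v : ℝ → ℝ} (hu : IsBoundedCausal u)
    (hv : IsBoundedCausal v) : ∃ M, 0 ≤ M ∧ ∀ a b, |u a * v b| ≤ M := by
  obtain ⟨M, hM⟩ := hu.bounded
  obtain ⟨N, hN⟩ := hv.bounded
  refine ⟨M * N, mul_nonneg ((abs_nonneg _).trans (hM 0)) ((abs_nonneg _).trans (hN 0)),
    fun a b => ?_⟩
  rw [abs_mul]
  exact mul_le_mul (hM a) (hN b) (abs_nonneg _) ((abs_nonneg _).trans (hM 0))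

theorem IsBoundedCausal.intervalIntegrable_mul {u v : ℝ → ℝ} (hu : IsBoundedCausal u)
    (hv : IsBoundedCausal v) (τ a b : ℝ) :
    IntervalIntegrable (fun t => u (t + τ) * v t) volume a b := by
  obtain ⟨M, hM0, hM⟩ := hu.exists_mul_bound hv
  exact (intervalIntegrable_const (c := M)).mono_fun
    ((hu.measurable_shift τ).mul hv.measurable).restrict
    (Eventually.of_forall fun t => (hM _ _).trans (le_abs_self M))

/-- `R` is the cross-correlation of the scalar signals `u` and `v`. -/
def HasCorrelation (u v R : ℝ → ℝ) : Prop :=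
  ∀ τ, Tendsto (fun T : ℝ => T⁻¹ * ∫ t in (0 : ℝ)..T, u (t + τ) * v t) atTop (𝓝 (R τ))

theorem HasCorrelation.add {u₁ u₂ v R₁ R₂ : ℝ → ℝ} (h₁ : HasCorrelation u₁ v R₁)
    (h₂ : HasCorrelation u₂ v R₂) (hu₁ : IsBoundedCausal u₁) (hu₂ : IsBoundedCausal u₂)
    (hv : IsBoundedCausal v) :
    HasCorrelation (fun t => u₁ t + u₂ t) v fun τ => R₁ τ + R₂ τ := by
  intro τ
  refine ((h₁ τ).add (h₂ τ)).congr fun T => ?_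
  rw [← mul_add, ← intervalIntegral.integral_add (hu₁.intervalIntegrable_mul hv τ 0 T)
    (hu₂.intervalIntegrable_mul hv τ 0 T)]
  simp only [add_mul]

theorem HasCorrelation.const_mul {u v R : ℝ → ℝ} (h : HasCorrelation u v R) (c : ℝ) :
    HasCorrelation (fun t => c * u t) v fun τ => c * R τ := by
  intro τ
  refine ((h τ).const_mul c).congr fun T => ?_
  simp only [mul_assoc, intervalIntegral.integral_const_mul]
  ring

theorem HasCorrelation.finsetSum {ι : Type*} (s : Finset ι) {u R : ι → ℝ → ℝ} {v : ℝ → ℝ}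
    (h : ∀ k, HasCorrelation (u k) v (R k)) (hu : ∀ k, IsBoundedCausal (u k))
    (hv : IsBoundedCausal v) :
    HasCorrelation (fun t => ∑ k ∈ s, u k t) v fun τ => ∑ k ∈ s, R k τ := by
  induction s using Finset.cons_induction with
  | empty => intro τ; simp
  | cons a s ha ih =>
    simpa only [Finset.sum_cons] using
      (h a).add ih (hu a) (IsBoundedCausal.finsetSum s hu) hv

/-- The integral over [0, T] stays below the L¹ norm of u times a bound for v, so the average is
O(1/T). -/
theorem hasCorrelation_zero_of_integrable {u v : ℝ → ℝ} (hu : Integrable u)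
    (hv : IsBoundedCausal v) : HasCorrelation u v fun _ => 0 := by
  intro τ
  obtain ⟨M, hM⟩ := hv.bounded
  have hM0 : 0 ≤ M := (abs_nonneg _).trans (hM 0)
  have huτ : Integrable fun t => |u (t + τ)| * M := (hu.comp_add_right τ).abs.mul_const M
  refine squeeze_zero_norm' (a := fun T => T⁻¹ * ∫ t, |u (t + τ)| * M) ?_
    (by simpa using (tendsto_inv_atTop_zero (𝕜 := ℝ)).mul_const (∫ t, |u (t + τ)| * M))
  filter_upwards [eventually_ge_atTop 0] with T hT
  rw [norm_mul, Real.norm_of_nonneg (inv_nonneg.2 hT)]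
  refine mul_le_mul_of_nonneg_left ?_ (inv_nonneg.2 hT)
  refine (intervalIntegral.norm_integral_le_of_norm_le hT ?_ huτ.intervalIntegrable).trans ?_
  · refine Eventually.of_forall fun t _ => ?_
    rw [norm_mul]
    exact mul_le_mul_of_nonneg_left (hM t) (norm_nonneg _)
  · rw [intervalIntegral.integral_of_le hT]
    exact setIntegral_le_integral huτ
      (Eventually.of_forall fun t => mul_nonneg (abs_nonneg _) hM0)

/-- Fubini moves the time average inside the s-integral. The averages of F are bounded by M
uniformly in T, so |g| M dominates and the limit may be taken under the integral. -/
theorem tendsto_average_integral_mul {g : ℝ → ℝ} {F : ℝ → ℝ → ℝ} {ρ : ℝ → ℝ} {M : ℝ}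
    (hg : IntegrableOn g (Set.Ioi 0))
    (hF : AEStronglyMeasurable (Function.uncurry F)
      ((volume : Measure ℝ).prod (volume.restrict (Set.Ioi 0))))
    (hM : ∀ t s, |F t s| ≤ M)
    (h : ∀ s, Tendsto (fun T : ℝ => T⁻¹ * ∫ t in (0 : ℝ)..T, F t s) atTop (𝓝 (ρ s))) :
    Tendsto (fun T : ℝ => T⁻¹ * ∫ t in (0 : ℝ)..T, ∫ s in Set.Ioi (0 : ℝ), g s * F t s) atTop
      (𝓝 (∫ s in Set.Ioi (0 : ℝ), g s * ρ s)) := by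
  have hint : ∀ T : ℝ, Integrable (Function.uncurry fun t s => g s * F t s)
      ((volume.restrict (Set.Ioc 0 T)).prod (volume.restrict (Set.Ioi 0))) := by
    intro T
    refine (hg.integrable.comp_snd (volume.restrict (Set.Ioc 0 T))).mul_bdd (c := M) ?_ ?_
    · exact hF.mono_ac (Measure.restrict_le_self.absolutelyContinuous.prod
        Measure.AbsolutelyContinuous.rfl)
    · exact Eventually.of_forall fun p => hM p.1 p.2
  have hswap : ∀ T : ℝ, 0 < T → ∫ s in Set.Ioi (0 : ℝ), g s * (T⁻¹ * ∫ t in (0 : ℝ)..T, F t s)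
      = T⁻¹ * ∫ t in (0 : ℝ)..T, ∫ s in Set.Ioi (0 : ℝ), g s * F t s := by
    intro T hT
    rw [intervalIntegral.integral_of_le hT.le, integral_integral_swap (hint T),
      ← integral_const_mul]
    congr 1
    ext s
    rw [integral_const_mul, intervalIntegral.integral_of_le hT.le]
    ring
  refine Tendsto.congr' ((eventually_gt_atTop 0).mono hswap) ?_
  refine tendsto_integral_filter_of_dominated_convergence (fun s => |g s| * M) ?_ ?_
    (hg.abs.mul_const M) (Eventually.of_forall fun s => (h s).const_mul (g s))
  · filter_upwards [eventually_gt_atTop 0] with T hT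
    refine ((hint T).integral_prod_right.aestronglyMeasurable.const_mul T⁻¹).congr ?_
    refine Eventually.of_forall fun s => ?_
    simp only [Function.uncurry_apply_pair]
    rw [integral_const_mul, intervalIntegral.integral_of_le hT.le]
    ring
  · filter_upwards [eventually_gt_atTop 0] with T hT
    refine Eventually.of_forall fun s => ?_
    rw [norm_mul]
    refine mul_le_mul_of_nonneg_left ?_ (norm_nonneg _)
    have h1 : ‖∫ t in (0 : ℝ)..T, F t s‖ ≤ M * |T - 0| :=
      intervalIntegral.norm_integral_le_of_norm_le_const fun t _ => hM t s
    rw [sub_zero, abs_of_pos hT] at h1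
    rw [norm_mul, Real.norm_of_nonneg (inv_pos.2 hT).le, inv_mul_le_iff₀ hT]
    linarith

theorem HasCorrelation.conv {g u v R : ℝ → ℝ} (h : HasCorrelation u v R)
    (hg : IntegrableOn g (Set.Ioi 0)) (hu : IsBoundedCausal u) (hv : IsBoundedCausal v) :
    HasCorrelation (fun t => ∫ s in Set.Ioi (0 : ℝ), g s * u (t - s)) v
      fun τ => ∫ s in Set.Ioi (0 : ℝ), g s * R (τ - s) := by
  intro τ
  obtain ⟨M, -, hM⟩ := hu.exists_mul_bound hv
  have hmeas : AEStronglyMeasurable (Function.uncurry fun t s => u (t + τ - s) * v t)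
      ((volume : Measure ℝ).prod (volume.restrict (Set.Ioi 0))) := by
    have h1 := (hu.measurable_shift τ).comp_quasiMeasurePreserving
      (quasiMeasurePreserving_sub_of_right_invariant volume (volume.restrict (Set.Ioi 0)))
    refine AEStronglyMeasurable.mul ?_ hv.measurable.comp_fst
    refine h1.congr (Eventually.of_forall fun p => ?_)
    simp only [Function.comp]
    congr 1
    ring
  refine (tendsto_average_integral_mul hg hmeas (fun t s => hM _ _) fun s => ?_).congr fun T => ?_
  · refine (h (τ - s)).congr fun T => ?_
    simp only [add_sub_assoc]
  · simp only [← mul_assoc, integral_mul_const]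

/-- Substituting t + τ for t shifts the averaging window by τ. The two mismatched end pieces have
length |τ| and bounded integrand, so they vanish after division by T. -/
theorem HasCorrelation.symm {u v R : ℝ → ℝ} (h : HasCorrelation u v R)
    (hu : IsBoundedCausal u) (hv : IsBoundedCausal v) :
    HasCorrelation v u fun τ => R (-τ) := by
  intro τ
  obtain ⟨M, -, hM⟩ := hu.exists_mul_bound hv
  have hint := hu.intervalIntegrable_mul hv (-τ)
  have hshift : ∀ T : ℝ, ∫ t in (0 : ℝ)..T, v (t + τ) * u t =
      (∫ t in (0 : ℝ)..T, u (t + -τ) * v t) + ((∫ t in T..(T + τ), u (t + -τ) * v t)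
        - ∫ t in (0 : ℝ)..τ, u (t + -τ) * v t) := by
    intro T
    have h1 := intervalIntegral.integral_comp_add_right (a := 0) (b := T)
      (fun t => u (t + -τ) * v t) τ
    simp only [add_neg_cancel_right, zero_add] at h1
    have h2 := intervalIntegral.integral_add_adjacent_intervals (hint 0 T) (hint T (T + τ))
    have h3 := intervalIntegral.integral_add_adjacent_intervals (hint 0 τ) (hint τ (T + τ))
    simp only [mul_comm (v _)]
    linarith
  have hbound : ∀ a b : ℝ, ‖∫ t in a..b, u (t + -τ) * v t‖ ≤ M * |b - a| := fun a b =>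
    intervalIntegral.norm_integral_le_of_norm_le_const fun t _ => hM _ _
  have hzero : Tendsto (fun T : ℝ => T⁻¹ * ((∫ t in T..(T + τ), u (t + -τ) * v t)
      - ∫ t in (0 : ℝ)..τ, u (t + -τ) * v t)) atTop (𝓝 0) := by
    refine squeeze_zero_norm' (a := fun T => T⁻¹ * (M * |τ| + M * |τ|)) ?_
      (by simpa using (tendsto_inv_atTop_zero (𝕜 := ℝ)).mul_const (M * |τ| + M * |τ|))
    filter_upwards [eventually_ge_atTop 0] with T hT
    rw [norm_mul, Real.norm_of_nonneg (inv_nonneg.2 hT)]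
    refine mul_le_mul_of_nonneg_left ((norm_sub_le _ _).trans (add_le_add ?_ ?_))
      (inv_nonneg.2 hT)
    · simpa using hbound T (T + τ)
    · simpa using hbound 0 τ
  have := (h (-τ)).add hzero
  rw [add_zero] at this
  refine this.congr fun T => ?_
  rw [hshift, mul_add]

/-! ### Spectral densities of system outputs -/

theorem norm_exp_I_mul (ω τ : ℝ) : ‖Complex.exp (Complex.I * ω * τ)‖ = 1 := by
  rw [show Complex.I * ω * τ = ((ω * τ : ℝ) : ℂ) * Complex.I by push_cast; ring,
    Complex.norm_exp_ofReal_mul_I]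

theorem integrable_exp_I_mul {μ : Measure ℝ} {f : ℝ → ℂ} (hf : Integrable f μ) (τ : ℝ) :
    Integrable (fun ω : ℝ => Complex.exp (Complex.I * ω * τ) * f ω) μ := by
  refine hf.bdd_mul (c := 1) (by fun_prop) ?_
  filter_upwards with ω
  exact (norm_exp_I_mul ω τ).le

/-- The exponential has modulus 1, so joint integrability reduces to that of g and f separately.
This licenses Fubini below and is where σ-finiteness of the spectral reference measure enters. -/
theorem integrable_fourier_prod {μ : Measure ℝ} [SigmaFinite μ] {g : ℝ → ℝ} {f : ℝ → ℂ}
    (hg : IntegrableOn g (Set.Ioi 0)) (hf : Integrable f μ) :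
    Integrable (fun p : ℝ × ℝ => Complex.exp (-(Complex.I * p.1 * p.2)) * (g p.2 : ℂ) * f p.1)
      (μ.prod (volume.restrict (Set.Ioi 0))) := by
  have h := (hf.mul_prod (hg.integrable.ofReal (𝕜 := ℂ))).bdd_mul (c := 1)
    (f := fun p : ℝ × ℝ => Complex.exp (-(Complex.I * p.1 * p.2))) (by fun_prop)
    (Eventually.of_forall fun p => (norm_exp_neg_I_mul p.1 p.2).le)
  refine h.congr (Eventually.of_forall fun p => ?_)
  simp only [RCLike.ofReal, Complex.coe_algebraMap]
  ring

theorem integrable_fourier_mul {μ : Measure ℝ} [SigmaFinite μ] {g : ℝ → ℝ} {f : ℝ → ℂ}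
    (hg : IntegrableOn g (Set.Ioi 0)) (hf : Integrable f μ) :
    Integrable (fun ω : ℝ => (∫ s in Set.Ioi (0 : ℝ),
      Complex.exp (-(Complex.I * ω * s)) * (g s : ℂ)) * f ω) μ := by
  refine (integrable_fourier_prod hg hf).integral_prod_left.congr (Eventually.of_forall fun ω => ?_)
  simp only [integral_mul_const]

/-- The convolution theorem relative to an arbitrary reference measure: e^{iω(τ-s)} factors, and
Fubini collects the s-integral into the Fourier transform of g. -/
theorem integral_mul_fourier_eq {μ : Measure ℝ} [SigmaFinite μ] {g R : ℝ → ℝ} {f : ℝ → ℂ} {c : ℂ}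
    (hg : IntegrableOn g (Set.Ioi 0)) (hf : Integrable f μ)
    (hR : ∀ τ : ℝ, (R τ : ℂ) = c * ∫ ω, Complex.exp (Complex.I * ω * τ) * f ω ∂μ) (τ : ℝ) :
    ((∫ s in Set.Ioi (0 : ℝ), g s * R (τ - s) : ℝ) : ℂ) =
      c * ∫ ω : ℝ, Complex.exp (Complex.I * ω * τ) * ((∫ s in Set.Ioi (0 : ℝ),
        Complex.exp (-(Complex.I * ω * s)) * (g s : ℂ)) * f ω) ∂μ := by
  have hint := integrable_fourier_prod hg (integrable_exp_I_mul hf τ)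
  calc ((∫ s in Set.Ioi (0 : ℝ), g s * R (τ - s) : ℝ) : ℂ)
      = ∫ s in Set.Ioi (0 : ℝ), (g s : ℂ) * (R (τ - s) : ℂ) := by
        rw [← integral_complex_ofReal]
        simp only [Complex.ofReal_mul]
    _ = ∫ s in Set.Ioi (0 : ℝ), c * ∫ ω : ℝ, Complex.exp (-(Complex.I * ω * s)) * (g s : ℂ) *
          (Complex.exp (Complex.I * ω * τ) * f ω) ∂μ := by
        congr 1
        ext s
        rw [hR, mul_left_comm, ← integral_const_mul]
        congr 2
        ext ω
        rw [show Complex.I * ω * ((τ - s : ℝ) : ℂ) = -(Complex.I * ω * s) + Complex.I * ω * τ by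
          push_cast; ring, Complex.exp_add]
        ring
    _ = c * ∫ ω : ℝ, (∫ s in Set.Ioi (0 : ℝ), Complex.exp (-(Complex.I * ω * s)) * (g s : ℂ) *
          (Complex.exp (Complex.I * ω * τ) * f ω)) ∂μ := by
        rw [integral_const_mul]
        exact congrArg (c * ·) (integral_integral_swap (f := fun ω s : ℝ =>
          Complex.exp (-(Complex.I * ω * s)) * (g s : ℂ) *
            (Complex.exp (Complex.I * ω * τ) * f ω)) hint).symm
    _ = _ := by
        congr 2
        ext ω
        rw [integral_mul_const]
        ring

/-- Swapping the signals replaces R(τ) by the transpose of R(-τ). As R is real, conjugating its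
Fourier representation restores the sign of τ and conjugates S. -/
theorem HasCrossSpectralDensity.symm {ι κ : Type*} {u : ℝ → ι → ℝ} {v : ℝ → κ → ℝ}
    {μ : Measure ℝ} {S : ℝ → Matrix ι κ ℂ} (h : HasCrossSpectralDensity u v μ S)
    (hu : ∀ i, IsBoundedCausal fun t => u t i) (hv : ∀ j, IsBoundedCausal fun t => v t j) :
    HasCrossSpectralDensity v u μ fun ω => (S ω)ᴴ := by
  obtain ⟨R, hR, hμ, hS, hRS⟩ := h
  refine ⟨fun τ => (R (-τ))ᵀ, fun τ j i => ?_, hμ, fun j i => ?_, fun τ j i => ?_⟩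
  · exact HasCorrelation.symm (R := fun τ => R τ i j) (fun τ => hR τ i j) (hu i) (hv j) τ
  · exact (Complex.conjCLE : ℂ →L[ℝ] ℂ).integrable_comp (hS i j)
  · change ((R (-τ) i j : ℝ) : ℂ) = (1 / (2 * Real.pi) : ℂ) *
      ∫ ω, Complex.exp (Complex.I * ω * τ) * (starRingEnd ℂ) (S ω i j) ∂μ
    rw [← Complex.conj_ofReal, hRS, map_mul, ← integral_conj]
    congr 1
    · rw [show (1 / (2 * Real.pi) : ℂ) = ((1 / (2 * Real.pi) : ℝ) : ℂ) by push_cast; rfl]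
      exact Complex.conj_ofReal _
    · congr 1
      ext ω
      rw [map_mul, ← Complex.exp_conj]
      simp

variable {σ ι ο κ : Type*} [Fintype σ] [DecidableEq σ] [Fintype ι]

theorem LTI.IsOutput.isBoundedCausal {G : LTI σ ι ο} (hG : IsHurwitz G.A)
    {u : ℝ → ι → ℝ} {z : ℝ → ο → ℝ} (hu : ∀ k, IsBoundedCausal fun t => u t k)
    (hz : G.IsOutput u z) (i : ο) : IsBoundedCausal fun t => z t i := by
  obtain ⟨a, ha, hza⟩ := hz.exists_eq hG hu
  simp only [hza]
  exact (ha i).1.add (IsBoundedCausal.finsetSum _ fun k =>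
    ((hu k).conv (G.integrableOn_impulse hG i k)).add ((hu k).const_mul _))

/-- By linearity the correlation is the sum of a vanishing transient part, the convolved R and the
feedthrough D R; the last two together have density T S. -/
theorem LTI.IsOutput.hasCrossSpectralDensity_left {G : LTI σ ι ο} (hG : IsHurwitz G.A)
    {u : ℝ → ι → ℝ} {z : ℝ → ο → ℝ} {v : ℝ → κ → ℝ} {μ : Measure ℝ} {S : ℝ → Matrix ι κ ℂ}
    (hu : ∀ k, IsBoundedCausal fun t => u t k) (hv : ∀ j, IsBoundedCausal fun t => v t j)
    (hz : G.IsOutput u z) (h : HasCrossSpectralDensity u v μ S) :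
    HasCrossSpectralDensity z v μ fun ω => G.transfer (Complex.I * ω) * S ω := by
  obtain ⟨a, ha, hza⟩ := hz.exists_eq hG hu
  obtain ⟨R, hR, hμ, hS, hRS⟩ := h
  have hg := fun i k => G.integrableOn_impulse hG i k
  have htransfer : ∀ (ω : ℝ) i j, (G.transfer (Complex.I * ω) * S ω) i j =
      ∑ k, ((∫ s in Set.Ioi (0 : ℝ), Complex.exp (-(Complex.I * ω * s)) *
        (G.impulse s i k : ℂ)) * S ω k j + (G.D i k : ℂ) * S ω k j) := by
    intro ω i j
    rw [mul_apply]
    exact Finset.sum_congr rfl fun k _ => by rw [G.transfer_apply hG, add_mul]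
  refine ⟨fun τ => of fun i j => ∑ k, ((∫ s in Set.Ioi (0 : ℝ), G.impulse s i k * R (τ - s) k j)
    + G.D i k * R τ k j), fun τ i j => ?_, hμ, fun i j => ?_, fun τ i j => ?_⟩
  · have hcorr : ∀ k, HasCorrelation (fun t => u t k) (fun t => v t j) fun τ => R τ k j :=
      fun k τ => hR τ k j
    have h1 := (hasCorrelation_zero_of_integrable (ha i).2 (hv j)).add
      (HasCorrelation.finsetSum Finset.univ
        (fun k => ((hcorr k).conv (hg i k) (hu k) (hv j)).add ((hcorr k).const_mul (G.D i k))
          ((hu k).conv (hg i k)) ((hu k).const_mul _) (hv j))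
        (fun k => ((hu k).conv (hg i k)).add ((hu k).const_mul _)) (hv j))
      (ha i).1 (IsBoundedCausal.finsetSum _ fun k =>
        ((hu k).conv (hg i k)).add ((hu k).const_mul _)) (hv j) τ
    simpa only [hza, zero_add, of_apply] using h1
  · simp only [htransfer]
    exact integrable_finsetSum _ fun k _ =>
      (integrable_fourier_mul (hg i k) (hS k j)).add ((hS k j).const_mul _)
  · simp only [htransfer, of_apply, Finset.mul_sum]
    rw [integral_finsetSum, Finset.mul_sum, Complex.ofReal_sum]
    · refine Finset.sum_congr rfl fun k _ => ?_
      rw [Complex.ofReal_add, Complex.ofReal_mul, integral_mul_fourier_eq (R := fun τ => R τ k j)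
        (hg i k) (hS k j) (fun τ => hRS τ k j), hRS τ k j]
      simp only [mul_add]
      rw [integral_add, mul_add]
      · congr 1
        rw [mul_left_comm, ← integral_const_mul]
        congr 2
        ext ω
        ring
      · exact integrable_exp_I_mul (integrable_fourier_mul (hg i k) (hS k j)) τ
      · exact integrable_exp_I_mul ((hS k j).const_mul _) τ
    · intro k _
      exact integrable_exp_I_mul ((integrable_fourier_mul (hg i k) (hS k j)).add
        ((hS k j).const_mul _)) τ

/-- The cross spectral density of the outputs of two stable systems is `G S H^*`. -/
theorem LTI.IsOutput.hasCrossSpectralDensity {σ' ι' ο' : Type*} [Fintype σ'] [DecidableEq σ']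
    [Fintype ι'] {G : LTI σ ι ο} {H : LTI σ' ι' ο'} (hG : IsHurwitz G.A) (hH : IsHurwitz H.A)
    {u : ℝ → ι → ℝ} {z : ℝ → ο → ℝ} {v : ℝ → ι' → ℝ} {y : ℝ → ο' → ℝ} {μ : Measure ℝ}
    {S : ℝ → Matrix ι ι' ℂ}
    (hu : ∀ k, IsBoundedCausal fun t => u t k) (hv : ∀ k, IsBoundedCausal fun t => v t k)
    (hz : G.IsOutput u z) (hy : H.IsOutput v y) (h : HasCrossSpectralDensity u v μ S) :
    HasCrossSpectralDensity z y μ fun ω =>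
      G.transfer (Complex.I * ω) * S ω * (H.transfer (Complex.I * ω))ᴴ := by
  have hzb := hz.isBoundedCausal hG hu
  -- Filtering is available only in the first argument, so the roles are swapped, H is applied, and
  -- the result is swapped back: (H (G S)*)* = G S H*.
  have h1 := (hz.hasCrossSpectralDensity_left hG hu hv h).symm hzb hv
  have h2 := (hy.hasCrossSpectralDensity_left hH hv hzb h1).symm (hy.isBoundedCausal hH hv) hzb
  simpa only [conjTranspose_mul, conjTranspose_conjTranspose] using h2

/-! ### Bounded power signals -/

section BoundedPower

variable {ι κ : Type*}

theorem BoundedPower.isBoundedCausal [Fintype ι] {u : ℝ → ι → ℝ} (hu : BoundedPower u) (i : ι) :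
    IsBoundedCausal fun t => u t i := by
  obtain ⟨M, hM⟩ := hu.bounded
  refine ⟨(continuous_apply i).comp_aestronglyMeasurable hu.measurable,
    fun t ht => by rw [hu.zero_of_neg t ht, Pi.zero_apply], |M|, fun t => ?_⟩
  rcases lt_or_ge t 0 with ht | ht
  · rw [hu.zero_of_neg t ht, Pi.zero_apply, abs_zero]
    exact abs_nonneg _
  · exact (norm_le_pi_norm (u t) i).trans ((hM t ht).trans (le_abs_self M))

theorem HasCrossCorrelation.tendsto_averagePower [Fintype ι] {u : ℝ → ι → ℝ}
    {R : ℝ → Matrix ι ι ℝ} (h : HasCrossCorrelation u u R)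
    (hu : ∀ i, IsBoundedCausal fun t => u t i) :
    Tendsto (averagePower u) atTop (𝓝 (R 0).trace) := by
  refine (tendsto_finsetSum Finset.univ fun i _ => h 0 i i).congr fun T => ?_
  rw [← Finset.mul_sum, ← intervalIntegral.integral_finsetSum]
  · simp only [averagePower, add_zero, sq]
  · exact fun i _ => (hu i).intervalIntegrable_mul (hu i) 0 0 T

theorem HasCrossCorrelation.powerNorm_sq [Fintype ι] {u : ℝ → ι → ℝ}
    {R : ℝ → Matrix ι ι ℝ} (h : HasCrossCorrelation u u R)
    (hu : ∀ i, IsBoundedCausal fun t => u t i) : powerNorm u ^ 2 = (R 0).trace := by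
  have ht := h.tendsto_averagePower hu
  rw [powerNorm, ht.limUnder_eq, Real.sq_sqrt]
  refine ge_of_tendsto ht ((eventually_ge_atTop 0).mono fun T hT => ?_)
  exact mul_nonneg (inv_nonneg.2 hT)
    (intervalIntegral.integral_nonneg hT fun t _ => Finset.sum_nonneg fun i _ => sq_nonneg _)

theorem HasCrossSpectralDensity.boundedPower [Fintype ι] {u : ℝ → ι → ℝ} {μ : Measure ℝ}
    {S : ℝ → Matrix ι ι ℂ} (h : HasCrossSpectralDensity u u μ S)
    (hu : ∀ i, IsBoundedCausal fun t => u t i) : BoundedPower u where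
  measurable :=
    (aemeasurable_pi_lambda u fun i => (hu i).measurable.aemeasurable).aestronglyMeasurable
  zero_of_neg t ht := funext fun i => (hu i).zero_of_neg t ht
  bounded := by
    choose M hM using fun i => (hu i).bounded
    refine ⟨∑ i, |M i|, fun t _ => (pi_norm_le_iff_of_nonneg
      (Finset.sum_nonneg fun i _ => abs_nonneg _)).2 fun i => ?_⟩
    exact ((hM i t).trans (le_abs_self _)).trans
      (Finset.single_le_sum (f := fun i => |M i|) (fun i _ => abs_nonneg _) (Finset.mem_univ i))
  spectrum := ⟨μ, S, h⟩
  power := by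
    obtain ⟨R, hR, -⟩ := h
    exact ⟨_, hR.tendsto_averagePower hu⟩

theorem HasCrossSpectralDensity.powerNorm_sq [Fintype ι] {u : ℝ → ι → ℝ} {μ : Measure ℝ}
    {S : ℝ → Matrix ι ι ℂ} (h : HasCrossSpectralDensity u u μ S)
    (hu : ∀ i, IsBoundedCausal fun t => u t i) :
    Integrable (fun ω => (S ω).trace) μ ∧
      ((powerNorm u ^ 2 : ℝ) : ℂ) = (1 / (2 * Real.pi) : ℂ) * ∫ ω, (S ω).trace ∂μ := by
  obtain ⟨R, hR, -, hS, hRS⟩ := h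
  refine ⟨integrable_finsetSum _ fun i _ => hS i i, ?_⟩
  rw [hR.powerNorm_sq hu]
  simp only [trace, diag_apply]
  rw [integral_finsetSum _ fun i _ => hS i i, Complex.ofReal_sum, Finset.mul_sum]
  refine Finset.sum_congr rfl fun i _ => ?_
  rw [hRS 0 i i]
  simp

theorem IsOrthogonal.hasCrossCorrelation {u : ℝ → ι → ℝ} {v : ℝ → κ → ℝ} (h : IsOrthogonal u v) :
    HasCrossCorrelation u v 0 := by
  obtain ⟨R, hR, -, -, hRS⟩ := h
  have hR0 : R = 0 := by
    ext τ i j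
    have := hRS τ i j
    simpa using this
  exact hR0 ▸ hR

/-- Expanding the product gives two cross terms; one vanishes by hypothesis, the other by symmetry
of correlations. -/
theorem HasCrossCorrelation.add_of_orthogonal {u v : ℝ → ι → ℝ} {R R' : ℝ → Matrix ι ι ℝ}
    (hu : ∀ i, IsBoundedCausal fun t => u t i) (hv : ∀ i, IsBoundedCausal fun t => v t i)
    (huR : HasCrossCorrelation u u R) (hvR : HasCrossCorrelation v v R')
    (h : HasCrossCorrelation u v 0) :
    HasCrossCorrelation (fun t => u t + v t) (fun t => u t + v t) fun τ => R τ + R' τ := by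
  intro τ i j
  have hvu : HasCorrelation (fun t => v t i) (fun t => u t j) fun _ => 0 :=
    HasCorrelation.symm (R := fun _ => 0) (fun τ => h τ j i) (hu j) (hv i)
  have h1 := ((huR τ i j).add (h τ i j)).add ((hvu τ).add (hvR τ i j))
  simp only [Pi.zero_apply, Matrix.zero_apply, add_zero, zero_add] at h1
  refine h1.congr fun T => ?_
  rw [← mul_add, ← mul_add, ← mul_add, ← intervalIntegral.integral_add
    ((hu i).intervalIntegrable_mul (hu j) τ 0 T) ((hu i).intervalIntegrable_mul (hv j) τ 0 T),
    ← intervalIntegral.integral_add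
    ((hv i).intervalIntegrable_mul (hu j) τ 0 T) ((hv i).intervalIntegrable_mul (hv j) τ 0 T),
    ← intervalIntegral.integral_add
    (((hu i).intervalIntegrable_mul (hu j) τ 0 T).add ((hu i).intervalIntegrable_mul (hv j) τ 0 T))
    (((hv i).intervalIntegrable_mul (hu j) τ 0 T).add ((hv i).intervalIntegrable_mul (hv j) τ 0 T))]
  congr 2
  ext t
  simp only [Pi.add_apply]
  ring

/-- A spectral density relative to `μ` can be rewritten relative to a dominating measure. -/
theorem IsSpectralDensity.of_absolutelyContinuous {R : ℝ → Matrix ι κ ℝ} {μ ν : Measure ℝ}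
    {S : ℝ → Matrix ι κ ℂ} (h : IsSpectralDensity R μ S) [SigmaFinite ν] (hμν : μ ≪ ν) :
    IsSpectralDensity R ν fun ω => (μ.rnDeriv ν ω).toReal • S ω := by
  obtain ⟨hμ, hS, hRS⟩ := h
  refine ⟨inferInstance, fun i j => (integrable_rnDeriv_smul_iff hμν).2 (hS i j),
    fun τ i j => ?_⟩
  rw [hRS, ← integral_rnDeriv_smul hμν]
  simp only [Matrix.smul_apply, mul_smul_comm]

theorem IsSpectralDensity.add {R R' : ℝ → Matrix ι κ ℝ} {μ : Measure ℝ}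
    {S S' : ℝ → Matrix ι κ ℂ} (h : IsSpectralDensity R μ S) (h' : IsSpectralDensity R' μ S') :
    IsSpectralDensity (fun τ => R τ + R' τ) μ fun ω => S ω + S' ω := by
  obtain ⟨hμ, hS, hRS⟩ := h
  obtain ⟨-, hS', hRS'⟩ := h'
  refine ⟨hμ, fun i j => (hS i j).add (hS' i j), fun τ i j => ?_⟩
  simp only [Matrix.add_apply, Complex.ofReal_add, mul_add]
  rw [integral_add (integrable_exp_I_mul (hS i j) τ) (integrable_exp_I_mul (hS' i j) τ),
    mul_add, hRS, hRS']

theorem IsOrthogonal.boundedPower_add [Fintype ι] {u v : ℝ → ι → ℝ} (h : IsOrthogonal u v)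
    (hu : BoundedPower u) (hv : BoundedPower v) :
    BoundedPower (fun t => u t + v t) ∧
      powerNorm (fun t => u t + v t) ^ 2 = powerNorm u ^ 2 + powerNorm v ^ 2 := by
  have hub := hu.isBoundedCausal
  have hvb := hv.isBoundedCausal
  have hb : ∀ i, IsBoundedCausal fun t => (u t + v t) i := fun i => (hub i).add (hvb i)
  obtain ⟨μ, S, R, hR, hRS⟩ := hu.spectrum
  obtain ⟨μ', S', R', hR', hRS'⟩ := hv.spectrum
  have hsum := hR.add_of_orthogonal hub hvb hR' h.hasCrossCorrelation
  have : SigmaFinite μ := hRS.1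
  have : SigmaFinite μ' := hRS'.1
  -- The two densities may refer to different measures; μ + μ' dominates both and lets them be
  -- added.
  have hS := (hRS.of_absolutelyContinuous (ν := μ + μ')
    (Measure.le_add_right le_rfl).absolutelyContinuous).add
    (hRS'.of_absolutelyContinuous (Measure.le_add_left le_rfl).absolutelyContinuous)
  refine ⟨HasCrossSpectralDensity.boundedPower ⟨_, hsum, hS⟩ hb, ?_⟩
  rw [hsum.powerNorm_sq hb, hR.powerNorm_sq hub, hR'.powerNorm_sq hvb, trace_add]

end BoundedPower

/-! ### Decomposition of the tracking loop -/

section States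

variable {σ σ' : Type*} [Fintype σ] [Fintype σ']

theorem isStateOf_iff_apply {x v : ℝ → σ → ℝ} : IsStateOf x v ↔
    ∀ i, ContinuousOn (fun t => x t i) (Set.Ici 0) ∧ ∀ t, 0 ≤ t →
      IntervalIntegrable (fun s => v s i) volume 0 t ∧
      x t i = x 0 i + ∫ s in (0 : ℝ)..t, v s i := by
  refine ⟨fun h i => ⟨continuousOn_pi.1 h.1 i, fun t ht =>
    ⟨h.intervalIntegrable_apply ht i, h.apply_eq ht i⟩⟩, fun h => ⟨continuousOn_pi.2 fun i =>
      (h i).1, fun t ht => ?_⟩⟩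
  have hint := fun i => ((h i).2 t ht).1
  refine ⟨⟨Integrable.of_eval fun i => (hint i).1, Integrable.of_eval fun i => (hint i).2⟩, ?_⟩
  ext i
  rw [((h i).2 t ht).2, Pi.add_apply, intervalIntegral.integral_of_le ht,
    intervalIntegral.integral_of_le ht, eval_integral fun i => (hint i).1]

theorem IsStateOf.congr {x v v' : ℝ → σ → ℝ} (h : IsStateOf x v)
    (hv : ∀ t, 0 ≤ t → v t = v' t) : IsStateOf x v' := by
  refine ⟨h.1, fun t ht => ?_⟩
  have hv' : ∀ s ∈ Set.uIcc 0 t, v s = v' s := fun s hs => by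
    rw [Set.uIcc_of_le ht] at hs
    exact hv s hs.1
  rw [← intervalIntegral.integral_congr hv']
  exact ⟨(h.2 t ht).1.congr fun s hs => hv' s (Set.uIoc_subset_uIcc hs), (h.2 t ht).2⟩

theorem IsStateOf.add {x y v v' : ℝ → σ → ℝ} (hx : IsStateOf x v) (hy : IsStateOf y v') :
    IsStateOf (fun t => x t + y t) fun t => v t + v' t := by
  rw [isStateOf_iff_apply] at *
  refine fun i => ⟨(hx i).1.add (hy i).1, fun t ht => ?_⟩
  obtain ⟨h1, h2⟩ := (hx i).2 t ht
  obtain ⟨h3, h4⟩ := (hy i).2 t ht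
  refine ⟨h1.add h3, ?_⟩
  simp only [Pi.add_apply]
  rw [h2, h4, intervalIntegral.integral_add h1 h3]
  ring

theorem IsStateOf.neg {x v : ℝ → σ → ℝ} (hx : IsStateOf x v) :
    IsStateOf (fun t => -x t) fun t => -v t := by
  rw [isStateOf_iff_apply] at *
  refine fun i => ⟨(hx i).1.neg, fun t ht => ?_⟩
  obtain ⟨h1, h2⟩ := (hx i).2 t ht
  refine ⟨h1.neg, ?_⟩
  simp only [Pi.neg_apply]
  rw [h2, intervalIntegral.integral_neg]
  ring

theorem IsStateOf.comp {x v : ℝ → σ → ℝ} (hx : IsStateOf x v) (e : σ' → σ) :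
    IsStateOf (fun t => x t ∘ e) fun t => v t ∘ e := by
  rw [isStateOf_iff_apply] at *
  exact fun i => hx (e i)

theorem IsStateOf.sumElim {x v : ℝ → σ → ℝ} {y v' : ℝ → σ' → ℝ} (hx : IsStateOf x v)
    (hy : IsStateOf y v') :
    IsStateOf (fun t => Sum.elim (x t) (y t)) fun t => Sum.elim (v t) (v' t) := by
  rw [isStateOf_iff_apply] at *
  rintro (i | i)
  · exact hx i
  · exact hy i

end States

section Loops

variable {n m₁ m₂ p₁ p₂ nc nk : Type*}
  [Fintype n] [Fintype m₂] [Fintype p₂] [Fintype nc] [Fintype nk]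

theorem Plant.IsNominalOutput.isOutput {P : Plant n m₁ m₂ p₁ p₂} {C : LTI nc p₂ m₂}
    {r : ℝ → p₂ → ℝ} {z : ℝ → p₁ → ℝ} (h : P.IsNominalOutput C r z) :
    (P.Tz₂r C).IsOutput r z := by
  obtain ⟨x, xc, y, u, hx, hy, hxc, hu, hz, hz0⟩ := h
  refine ⟨fun t => Sum.elim (x t) (xc t), (hx.sumElim hxc).congr fun t ht => ?_,
    fun t ht => ?_, hz0⟩
  · rw [hu t ht, hy t ht]
    simp only [Plant.Tz₂r, Plant.loopMatrix, fromBlocks_mulVec, fromRows_mulVec,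
      Sum.elim_comp_inl, Sum.elim_comp_inr, ← Sum.elim_add_add, mulVec_add, add_mulVec,
      mulVec_sub, neg_mulVec, ← mulVec_mulVec]
    congr 1 <;> abel
  · rw [hz t ht, hu t ht, hy t ht]
    simp only [Plant.Tz₂r, fromCols_mulVec_sumElim, mulVec_add, add_mulVec, mulVec_sub,
      neg_mulVec, ← mulVec_mulVec]
    abel

variable [Fintype m₁]

theorem Plant.IsRobustOutput.isOutput {P : Plant n m₁ m₂ p₁ p₂} {K : LTI nk p₂ m₂}
    {w : ℝ → m₁ → ℝ} {z : ℝ → p₁ → ℝ} (h : P.IsRobustOutput K w z) :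
    (P.Tz₁w K).IsOutput w z := by
  obtain ⟨x, xk, y, u, hx, hy, hxk, hu, hz, hz0⟩ := h
  refine ⟨fun t => Sum.elim (x t) (xk t), (hx.sumElim hxk).congr fun t ht => ?_,
    fun t ht => ?_, hz0⟩
  · rw [hu t ht, hy t ht]
    simp only [Plant.Tz₁w, Plant.loopMatrix, fromBlocks_mulVec, fromRows_mulVec,
      Sum.elim_comp_inl, Sum.elim_comp_inr, ← Sum.elim_add_add, mulVec_add, add_mulVec,
      ← mulVec_mulVec]
    congr 1 <;> abel
  · rw [hz t ht, hu t ht, hy t ht]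
    simp only [Plant.Tz₁w, fromCols_mulVec_sumElim, mulVec_add, add_mulVec, ← mulVec_mulVec]
    abel

/-- The output of the tracking loop splits into an output of the robust loop driven by `w` and an
output of the nominal loop driven by `r`. -/
theorem Plant.IsTrackingOutput.exists_eq_add [DecidableEq n] [DecidableEq nc] [DecidableEq nk]
    {P : Plant n m₁ m₂ p₁ p₂} {C : LTI nc p₂ m₂} {K : LTI nk p₂ m₂} {L : Matrix n p₂ ℝ}
    {Lc : Matrix nc m₂ ℝ} {w : ℝ → m₁ → ℝ} {r : ℝ → p₂ → ℝ} {z : ℝ → p₁ → ℝ}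
    (h : P.IsTrackingOutput C L Lc (P.Q C K L Lc) w r z) :
    ∃ z₁ z₂ : ℝ → p₁ → ℝ, P.IsRobustOutput K w z₁ ∧ P.IsNominalOutput C r z₂ ∧
      z = fun t => z₁ t + z₂ t := by
  obtain ⟨x, xhat, xc, xq, y, f, u, uc, uq, hx, hy, hxc, huc, hxhat, hf, hxq, huq, hu, hz, hz0⟩ := h
  have hq₁ := hxq.comp Sum.inl
  have hq₂ := hxq.comp (Sum.inr ∘ Sum.inl)
  have hq₃ := hxq.comp (Sum.inr ∘ Sum.inr)
  obtain ⟨q₁, hq₁_def⟩ : ∃ q₁ : ℝ → nc → ℝ, q₁ = fun t => xq t ∘ Sum.inl := ⟨_, rfl⟩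
  obtain ⟨q₂, hq₂_def⟩ : ∃ q₂ : ℝ → n → ℝ, q₂ = fun t => xq t ∘ Sum.inr ∘ Sum.inl := ⟨_, rfl⟩
  obtain ⟨q₃, hq₃_def⟩ : ∃ q₃ : ℝ → nk → ℝ, q₃ = fun t => xq t ∘ Sum.inr ∘ Sum.inr := ⟨_, rfl⟩
  have hxq_eq : ∀ t, xq t = Sum.elim (q₁ t) (Sum.elim (q₂ t) (q₃ t)) := fun t => by
    ext (i | i | i) <;> simp [hq₁_def, hq₂_def, hq₃_def]
  rw [← hq₁_def] at hq₁
  rw [← hq₂_def] at hq₂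
  rw [← hq₃_def] at hq₃
  simp only [Plant.Q, hxq_eq, fromBlocks_mulVec, fromRows_mulVec, fromCols_mulVec,
    Sum.elim_comp_inl, Sum.elim_comp_inr, ← Sum.elim_add_add, ← Function.comp_assoc,
    zero_mulVec, zero_add] at hq₁ hq₂ hq₃ huq
  -- The term L f enters q₂ and x̂ alike, so it cancels in x₁, and y₁ = C₂q₂ - f is exactly the
  -- measurement driving the K-part of Q.
  set x₁ : ℝ → n → ℝ := fun t => q₂ t + -xhat t + x t with hx₁_def
  set y₁ : ℝ → p₂ → ℝ := fun t => P.C₂ *ᵥ x₁ t + P.D₂₁ *ᵥ w t with hy₁_def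
  set u₁ : ℝ → m₂ → ℝ := fun t => K.C *ᵥ q₃ t + K.D *ᵥ y₁ t with hu₁_def
  set x₂ : ℝ → n → ℝ := fun t => xhat t + -q₂ t with hx₂_def
  -- The equations of xc and q₁ both contain -Lc uq, so Lc drops out of the difference. The input
  -- left to C is y + f - C₂q₂ - r = C₂x₂ - r.
  set xc₂ : ℝ → nc → ℝ := fun t => xc t + -q₁ t with hxc₂_def
  set u₂ : ℝ → m₂ → ℝ := fun t => C.C *ᵥ xc₂ t + C.D *ᵥ (P.C₂ *ᵥ x₂ t - r t) with hu₂_def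
  -- The loop equations constrain only t ≥ 0; truncation makes the outputs vanish before time 0, as
  -- signals must.
  refine ⟨(Set.Ici 0).indicator fun t => P.C₁ *ᵥ (P.C₂ *ᵥ x₁ t) + P.D₁₂ *ᵥ u₁ t,
    (Set.Ici 0).indicator fun t => P.C₁ *ᵥ (P.C₂ *ᵥ x₂ t - r t) + P.D₁₂ *ᵥ u₂ t,
    ⟨x₁, q₃, y₁, u₁, ?_, fun _ _ => rfl, ?_, fun _ _ => rfl, ?_, ?_⟩,
    ⟨x₂, xc₂, fun t => P.C₂ *ᵥ x₂ t, u₂, ?_, fun _ _ => rfl, ?_, fun _ _ => rfl, ?_, ?_⟩, ?_⟩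
  · refine ((hq₂.add hxhat.neg).add hx).congr fun t ht => ?_
    rw [hf t ht, hy t ht]
    simp only [hu₁_def, hy₁_def, hx₁_def, mulVec_add, add_mulVec, mulVec_sub, sub_mulVec,
      mulVec_neg, ← mulVec_mulVec]
    abel
  · refine hq₃.congr fun t ht => ?_
    rw [hf t ht, hy t ht]
    simp only [hy₁_def, hx₁_def, mulVec_add, mulVec_sub,
      mulVec_neg, neg_mulVec, ← mulVec_mulVec]
    abel
  · exact fun t ht => Set.indicator_of_mem (Set.mem_Ici.2 ht) _
  · exact fun t ht => Set.indicator_of_notMem (by simpa using ht) _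
  · refine (hxhat.add hq₂.neg).congr fun t ht => ?_
    rw [hu t ht, huc t ht, huq t ht, hf t ht, hy t ht]
    simp only [hu₂_def, hx₂_def, hxc₂_def, mulVec_add, add_mulVec, mulVec_sub, sub_mulVec,
      mulVec_neg, neg_mulVec, ← mulVec_mulVec]
    abel
  · refine (hxc.add hq₁.neg).congr fun t ht => ?_
    rw [hu t ht, huc t ht, huq t ht, hf t ht, hy t ht]
    simp only [hx₂_def, hxc₂_def, mulVec_add, add_mulVec, mulVec_sub, sub_mulVec,
      mulVec_neg, neg_mulVec, ← mulVec_mulVec]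
    abel
  · exact fun t ht => Set.indicator_of_mem (Set.mem_Ici.2 ht) _
  · exact fun t ht => Set.indicator_of_notMem (by simpa using ht) _
  · ext1 t
    by_cases ht : 0 ≤ t
    · rw [Set.indicator_of_mem (Set.mem_Ici.2 ht), Set.indicator_of_mem (Set.mem_Ici.2 ht),
        hz t ht, hu t ht, huc t ht, huq t ht, hf t ht, hy t ht]
      simp only [hu₁_def, hy₁_def, hx₁_def, hu₂_def, hx₂_def, hxc₂_def, mulVec_add,
        mulVec_sub, sub_mulVec, mulVec_neg, neg_mulVec, ← mulVec_mulVec]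
      abel
    · rw [Set.indicator_of_notMem (by simpa using ht), Set.indicator_of_notMem (by simpa using ht),
        hz0 t (not_le.1 ht), add_zero]

end Loops

end MOCC

/-! ### Additivity of the output power. -/

theorem theorem1 {n m₁ m₂ p₁ p₂ nc nk : ℕ}
    (P : MOCC.Plant (Fin n) (Fin m₁) (Fin m₂) (Fin p₁) (Fin p₂))
    (C : MOCC.LTI (Fin nc) (Fin p₂) (Fin m₂)) (K : MOCC.LTI (Fin nk) (Fin p₂) (Fin m₂))
    (hC : P.Stabilizes C) (hK : P.Stabilizes K)
    (L : Matrix (Fin n) (Fin p₂) ℝ) (hL : MOCC.IsHurwitz (P.A + L * P.C₂))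
    (Lc : Matrix (Fin nc) (Fin m₂) ℝ) (hLc : MOCC.IsHurwitz (C.A + Lc * C.C))
    (w : ℝ → Fin m₁ → ℝ) (r : ℝ → Fin p₂ → ℝ)
    (hw : MOCC.BoundedPower w) (hr : MOCC.BoundedPower r) (hwr : MOCC.IsOrthogonal w r)
    (z z₁ z₂ : ℝ → Fin p₁ → ℝ)
    (hz : P.IsTrackingOutput C L Lc (P.Q C K L Lc) w r z)
    (hz₁ : P.IsRobustOutput K w z₁) (hz₂ : P.IsNominalOutput C r z₂) :
    MOCC.BoundedPower z ∧ MOCC.BoundedPower z₁ ∧ MOCC.BoundedPower z₂ ∧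
    MOCC.powerNorm z ^ 2 = MOCC.powerNorm z₁ ^ 2 + MOCC.powerNorm z₂ ^ 2 ∧
    (∀ (μ : MeasureTheory.Measure ℝ) (Sww : ℝ → Matrix (Fin m₁) (Fin m₁) ℂ),
      MOCC.HasCrossSpectralDensity w w μ Sww →
        MeasureTheory.Integrable (MOCC.traceIntegrand (P.Tz₁w K) Sww) μ ∧
        ((MOCC.powerNorm z₁ ^ 2 : ℝ) : ℂ) =
          (1 / (2 * Real.pi) : ℂ) * ∫ ω, MOCC.traceIntegrand (P.Tz₁w K) Sww ω ∂μ) ∧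
    (∀ (μ : MeasureTheory.Measure ℝ) (Srr : ℝ → Matrix (Fin p₂) (Fin p₂) ℂ),
      MOCC.HasCrossSpectralDensity r r μ Srr →
        MeasureTheory.Integrable (MOCC.traceIntegrand (P.Tz₂r C) Srr) μ ∧
        ((MOCC.powerNorm z₂ ^ 2 : ℝ) : ℂ) =
          (1 / (2 * Real.pi) : ℂ) * ∫ ω, MOCC.traceIntegrand (P.Tz₂r C) Srr ω ∂μ) := by
  have hwb := hw.isBoundedCausal
  have hrb := hr.isBoundedCausal
  have hA₁ : MOCC.IsHurwitz (P.Tz₁w K).A := hK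
  have hA₂ : MOCC.IsHurwitz (P.Tz₂r C).A := hC
  have power₁ : ∀ {ζ}, P.IsRobustOutput K w ζ → ∀ {μ S},
      MOCC.HasCrossSpectralDensity w w μ S → MOCC.BoundedPower ζ ∧
        MeasureTheory.Integrable (MOCC.traceIntegrand (P.Tz₁w K) S) μ ∧
        ((MOCC.powerNorm ζ ^ 2 : ℝ) : ℂ) =
          (1 / (2 * Real.pi) : ℂ) * ∫ ω, MOCC.traceIntegrand (P.Tz₁w K) S ω ∂μ := by
    intro ζ hζ μ S hS
    have hS' := hζ.isOutput.hasCrossSpectralDensity hA₁ hA₁ hwb hwb hζ.isOutput hS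
    have hb := hζ.isOutput.isBoundedCausal hA₁ hwb
    exact ⟨hS'.boundedPower hb, hS'.powerNorm_sq hb⟩
  have power₂ : ∀ {ζ}, P.IsNominalOutput C r ζ → ∀ {μ S},
      MOCC.HasCrossSpectralDensity r r μ S → MOCC.BoundedPower ζ ∧
        MeasureTheory.Integrable (MOCC.traceIntegrand (P.Tz₂r C) S) μ ∧
        ((MOCC.powerNorm ζ ^ 2 : ℝ) : ℂ) =
          (1 / (2 * Real.pi) : ℂ) * ∫ ω, MOCC.traceIntegrand (P.Tz₂r C) S ω ∂μ := by
    intro ζ hζ μ S hS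
    have hS' := hζ.isOutput.hasCrossSpectralDensity hA₂ hA₂ hrb hrb hζ.isOutput hS
    have hb := hζ.isOutput.isBoundedCausal hA₂ hrb
    exact ⟨hS'.boundedPower hb, hS'.powerNorm_sq hb⟩
  obtain ⟨μw, Sw, hSw⟩ := hw.spectrum
  obtain ⟨μr, Sr, hSr⟩ := hr.spectrum
  obtain ⟨ζ₁, ζ₂, hζ₁, hζ₂, rfl⟩ := hz.exists_eq_add
  -- Orthogonality of w and r survives filtering: the cross density of the outputs is T₁ 0 T₂*.
  have horth : MOCC.IsOrthogonal ζ₁ ζ₂ := by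
    have h := hζ₁.isOutput.hasCrossSpectralDensity hA₁ hA₂ hwb hrb hζ₂.isOutput hwr
    simp only [Matrix.mul_zero, Matrix.zero_mul] at h
    exact h
  obtain ⟨hb, hsum⟩ := horth.boundedPower_add (power₁ hζ₁ hSw).1 (power₂ hζ₂ hSr).1
  -- ζ₁ and z₁ may start from different initial states, but both powers equal the same spectral
  -- integral; likewise for ζ₂ and z₂.
  have h₁ : MOCC.powerNorm ζ₁ ^ 2 = MOCC.powerNorm z₁ ^ 2 :=
    Complex.ofReal_injective ((power₁ hζ₁ hSw).2.2.trans (power₁ hz₁ hSw).2.2.symm)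
  have h₂ : MOCC.powerNorm ζ₂ ^ 2 = MOCC.powerNorm z₂ ^ 2 :=
    Complex.ofReal_injective ((power₂ hζ₂ hSr).2.2.trans (power₂ hz₂ hSr).2.2.symm)
  exact ⟨hb, (power₁ hz₁ hSw).1, (power₂ hz₂ hSr).1, by rw [hsum, h₁, h₂],
    fun μ S hS => (power₁ hz₁ hS).2, fun μ S hS => (power₂ hz₂ hS).2⟩
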